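/- Let $\beta\ge 0$. Let $Q^{(\beta)}=(Q^{(\beta)}_t)_{t\ge0}$ be the Feller semigroup on $C_0([0,\infty))$ of the (scaled) squared Bessel process of index $\beta-1$, i.e. the unique Feller semigroup whose generator acts on $C_c^\infty([0,\infty))$ as $x\,\partial^2+\beta\,\partial$, and let $\mathbb Q^{(\beta)}=(\mathbb Q^{(\beta)}_t)_{t\ge0}$ be the Feller semigroup on $c_0(\mathbb Z_+)$ of the linear birth–death process with birth rates $n+\beta$ and death rates $n$, i.e. the unique Feller semigroup whose generator acts on finitely supported functions as $(n+\beta)\partial_++n\,\partial_-$, where $\partial_\pm g(n)=g(n\pm1)-g(n)$ (Feller semigroups are understood to be conservative). For $g\in c_0(\mathbb Z_+)$ let $\Lambda g(x)=\mathbb E[g(\mathrm{Pois}(x))]$, $x\ge0$, where $\mathrm{Pois}(x)$ is a Poisson variable of parameter $x$; for $\sigma\in(0,1]$ let $\mathbb D_\sigma g(n)=\sum_{m=0}^n\binom nm\sigma^m(1-\sigma)^{n-m}g(m)$, and let $d_\sigma f(x)=f(\sigma x)$. For $t\ge0$ put $$K^{(\beta)}_t=Q^{(\beta)}_{e^t-1}\,d_{e^{-t}}\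 \text{ on } C_0([0,\infty)),\qquad \mathbb K^{(\beta)}_t=\mathbb Q^{(\beta)}_{e^t-1}\,\mathbb D_{e^{-t}}\ \text{ on } c_0(\mathbb Z_+).$$ Then $(\mathbb K^{(\beta)}_t)_{t\ge0}$ is the Feller semigroup on $c_0(\mathbb Z_+)$ of a birth–death chain on $\mathbb Z_+$, namely of the one with birth rates $n+\beta$ and death rates $2n$: it is a Feller semigroup whose generator acts on finitely supported functions as $(n+\beta)\partial_++2n\,\partial_-$. Moreover, for every $t\ge0$, $$K^{(\beta)}_t\,\Lambda=\Lambda\,\mathbb K^{(\beta)}_t\quad\text{on } c_0(\mathbb Z_+).$$ -/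

import Mathlib

noncomputable section

namespace Gateway

open Filter Topology
open scoped NNReal ZeroAtInfty ContDiff

/-! ### Feller semigroups and their generators -/

/-- A (conservative) Feller semigroup on `C₀(E)`: a strongly continuous semigroup of positive
contractions which is Markovian. As the constant function `1` need not belong to `C₀(E)`, the
Markov property `T t 1 = 1` is expressed by saying that the total mass
`sup {T t f x | f ∈ C₀(E), 0 ≤ f ≤ 1}` of the transition probability from `x` is `1`. -/
structure IsFellerSemigroup {E : Type*} [TopologicalSpace E]
    (T : ℝ≥0 → C₀(E, ℝ) →L[ℝ] C₀(E, ℝ)) : Prop where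
  zero : T 0 = ContinuousLinearMap.id ℝ C₀(E, ℝ)
  add : ∀ s t : ℝ≥0, T (s + t) = (T s).comp (T t)
  nonneg : ∀ (t : ℝ≥0) (f : C₀(E, ℝ)), (∀ x, 0 ≤ f x) → ∀ x, 0 ≤ T t f x
  contraction : ∀ t : ℝ≥0, ‖T t‖ ≤ 1
  markov : ∀ (t : ℝ≥0) (x : E),
    IsLUB {r : ℝ | ∃ f : C₀(E, ℝ), (∀ y, 0 ≤ f y) ∧ (∀ y, f y ≤ 1) ∧ T t f x = r} 1
  tendsto_zero : ∀ f : C₀(E, ℝ), Tendsto (fun t : ℝ≥0 => T t f) (𝓝 0) (𝓝 f)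

/-- `f` belongs to the domain of the infinitesimal generator of `T`, and the generator maps
`f` to the function `h`: the difference quotients `(T t f - f) / t` converge uniformly to `h`
as `t` decreases to `0`, and `h` is in `C₀(E)`. -/
def GeneratorMapsTo {E : Type*} [TopologicalSpace E]
    (T : ℝ≥0 → C₀(E, ℝ) →L[ℝ] C₀(E, ℝ)) (f : C₀(E, ℝ)) (h : E → ℝ) : Prop :=
  ∃ g : C₀(E, ℝ), (∀ x, g x = h x) ∧
    Tendsto (fun t : ℝ≥0 => (t : ℝ)⁻¹ • (T t f - f)) (𝓝[>] 0) (𝓝 g)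

/-! ### Birth–death chains on `ℤ₊` -/

/-- The difference operator `b(n) ∂₊ + d(n) ∂₋`, where `∂± f(n) = f(n ± 1) - f(n)`, with birth
rates `b` and death rates `d`. At `n = 0` the second term vanishes. -/
def birthDeathOperator (b d : ℕ → ℝ) (f : ℕ → ℝ) (n : ℕ) : ℝ :=
  b n * (f (n + 1) - f n) + d n * (f (n - 1) - f n)

/-- `T` is the Feller semigroup on `c₀(ℤ₊)` of a birth–death chain with birth rates `b` and
death rates `d`: its generator is given on the finitely supported functions by the tridiagonal
rate matrix of the chain. -/
structure IsBirthDeathSemigroup (b d : ℕ → ℝ) (T : ℝ≥0 → C₀(ℕ, ℝ) →L[ℝ] C₀(ℕ, ℝ)) : Prop where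
  birth_nonneg : ∀ n, 0 ≤ b n
  death_nonneg : ∀ n, 0 ≤ d n
  death_zero : d 0 = 0
  feller : IsFellerSemigroup T
  generator : ∀ f : C₀(ℕ, ℝ), (Function.support f).Finite →
    GeneratorMapsTo T f (birthDeathOperator b d f)

open Classical in
/-- The Feller semigroup of the linear birth–death process, with generator
`(n + β) ∂₊ + n ∂₋`: the unique birth–death semigroup with these rates. -/
def discreteBessel (β : ℝ) : ℝ≥0 → C₀(ℕ, ℝ) →L[ℝ] C₀(ℕ, ℝ) :=
  if h : ∃! T, IsBirthDeathSemigroup (fun n => n + β) (fun n => n) T then h.choose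
  else fun _ => 0

/-! ### The squared Bessel semigroup -/

/-- `T` is a Feller semigroup on `C₀([0, ∞))` whose generator acts on `C_c^∞([0, ∞))` (smooth up
to the boundary point `0`, which it does not have to avoid) as `x ∂² + β ∂`. -/
structure IsSquaredBesselSemigroup (β : ℝ) (T : ℝ≥0 → C₀(ℝ≥0, ℝ) →L[ℝ] C₀(ℝ≥0, ℝ)) :
    Prop where
  feller : IsFellerSemigroup T
  generator : ∀ (F : ℝ → ℝ) (f : C₀(ℝ≥0, ℝ)), ContDiff ℝ ∞ F → HasCompactSupport F →
    (∀ x : ℝ≥0, f x = F x) →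
    GeneratorMapsTo T f (fun x => x * deriv (deriv F) x + β * deriv F x)

open Classical in
/-- The Feller semigroup of the (scaled) squared Bessel process of index `β - 1`, with generator
`x ∂² + β ∂`: the unique semigroup as above. -/
def squaredBessel (β : ℝ) : ℝ≥0 → C₀(ℝ≥0, ℝ) →L[ℝ] C₀(ℝ≥0, ℝ) :=
  if h : ∃! T, IsSquaredBesselSemigroup β T then h.choose else fun _ => 0

/-! ### Operators given by Markov kernels with values in `ℤ₊` -/

/-- A Markov kernel from `X` to `ℤ₊` mapping indicators of points into `C₀(X)`. -/
structure IsC0MarkovKernel {X : Type*} [TopologicalSpace X] (p : X → ℕ → ℝ) : Prop where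
  nonneg : ∀ x m, 0 ≤ p x m
  hasSum_one : ∀ x, HasSum (p x) 1
  continuous : ∀ m, Continuous fun x => p x m
  tendsto_zero : ∀ m, Tendsto (fun x => p x m) (cocompact X) (𝓝 0)

section kernel

variable {X : Type*} [TopologicalSpace X] {p : X → ℕ → ℝ}

theorem abs_apply_le_norm {Y : Type*} [TopologicalSpace Y] (f : C₀(Y, ℝ)) (y : Y) :
    |f y| ≤ ‖f‖ := by
  have h := f.toBCF.norm_coe_le_norm y
  simpa using h

theorem IsC0MarkovKernel.summable_of_le (hp : IsC0MarkovKernel p) {g : ℕ → ℝ} {C : ℝ}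
    (hg : ∀ m, |g m| ≤ C) (x : X) : Summable fun m => p x m * g m := by
  refine Summable.of_norm_bounded ((hp.hasSum_one x).summable.mul_right C) fun m => ?_
  rw [norm_mul, Real.norm_of_nonneg (hp.nonneg x m), Real.norm_eq_abs]
  exact mul_le_mul_of_nonneg_left (hg m) (hp.nonneg x m)

theorem IsC0MarkovKernel.abs_tsum_le (hp : IsC0MarkovKernel p) {g : ℕ → ℝ} {C : ℝ}
    (hg : ∀ m, |g m| ≤ C) (x : X) : |∑' m, p x m * g m| ≤ C := by
  have h1 : HasSum (fun m => p x m * C) C := by simpa using (hp.hasSum_one x).mul_right C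
  rw [← Real.norm_eq_abs]
  refine tsum_of_norm_bounded h1 fun m => ?_
  rw [norm_mul, Real.norm_of_nonneg (hp.nonneg x m), Real.norm_eq_abs]
  exact mul_le_mul_of_nonneg_left (hg m) (hp.nonneg x m)

theorem IsC0MarkovKernel.tendstoUniformly (hp : IsC0MarkovKernel p) (f : C₀(ℕ, ℝ)) :
    TendstoUniformly (fun (N : ℕ) x => ∑ m ∈ Finset.range N, p x m * f m)
      (fun x => ∑' m, p x m * f m) atTop := by
  rw [Metric.tendstoUniformly_iff]
  intro ε hε
  have hf : Tendsto f atTop (𝓝 0) := by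
    have := f.zero_at_infty'
    rwa [cocompact_eq_cofinite, Nat.cofinite_eq_atTop] at this
  obtain ⟨N, hN⟩ := Metric.tendsto_atTop.1 hf (ε / 2) (by positivity)
  filter_upwards [eventually_ge_atTop N] with M hM x
  have hs : Summable fun m => p x m * f m := hp.summable_of_le (abs_apply_le_norm f) x
  set g : ℕ → ℝ := fun m => if m ∈ Finset.range M then 0 else f m with hg
  have hgle : ∀ m, |g m| ≤ ε / 2 := by
    intro m
    by_cases hm : m < M
    · simp [hg, hm]; positivity
    · have := hN m (by omega)
      rw [Real.dist_eq, sub_zero] at this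
      simp [hg, hm, this.le]
  have h2 : ∑' m, p x m * f m - ∑ m ∈ Finset.range M, p x m * f m = ∑' m, p x m * g m := by
    have hfin : ∑ m ∈ Finset.range M, p x m * f m
        = ∑' m, (if m ∈ Finset.range M then p x m * f m else 0) := by
      rw [tsum_eq_sum (s := Finset.range M)]
      · exact Finset.sum_congr rfl fun m hm => by rw [if_pos hm]
      · intro m hm; rw [if_neg hm]
    rw [hfin, ← hs.tsum_sub]
    · refine tsum_congr fun m => ?_
      by_cases hm : m ∈ Finset.range M <;> simp only [hg, hm, if_true, if_false] <;> ring
    · exact summable_of_ne_finset_zero (s := Finset.range M) fun m hm => by rw [if_neg hm]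
  rw [Real.dist_eq, h2]
  exact (hp.abs_tsum_le hgle x).trans_lt (by linarith)

/-- The operator `f ↦ (x ↦ ∑ₘ p(x, m) f(m))` from `c₀(ℤ₊)` to `C₀(X)`. -/
def kernelOperator (p : X → ℕ → ℝ) (hp : IsC0MarkovKernel p) : C₀(ℕ, ℝ) →L[ℝ] C₀(X, ℝ) :=
  LinearMap.mkContinuous
    { toFun := fun f =>
        { toFun := fun x => ∑' m, p x m * f m
          continuous_toFun := (hp.tendstoUniformly f).continuous
            (Frequently.of_forall fun N => continuous_finsetSum _ fun m _ =>
              (hp.continuous m).mul continuous_const)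
          zero_at_infty' := by
            refine (hp.tendstoUniformly f).tendstoUniformlyOnFilter.mono_right le_top
              |>.tendsto_of_eventually_tendsto (L := fun _ => 0)
              (Eventually.of_forall fun N => ?_) tendsto_const_nhds
            simpa using tendsto_finsetSum (Finset.range N) fun m _ =>
              (hp.tendsto_zero m).mul_const (f m) }
      map_add' := fun f g => by
        ext x
        change ∑' m, p x m * (f m + g m) = ∑' m, p x m * f m + ∑' m, p x m * g m
        rw [← (hp.summable_of_le (abs_apply_le_norm f) x).tsum_add
          (hp.summable_of_le (abs_apply_le_norm g) x)]
        exact tsum_congr fun m => mul_add _ _ _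
      map_smul' := fun c f => by
        ext x
        change ∑' m, p x m * (c * f m) = c * ∑' m, p x m * f m
        rw [← tsum_mul_left]
        exact tsum_congr fun m => by ring } 1
    (fun f => by
      rw [one_mul]
      refine (BoundedContinuousFunction.norm_le (norm_nonneg f)).2 fun x => ?_
      rw [Real.norm_eq_abs]
      exact hp.abs_tsum_le (abs_apply_le_norm f) x)

end kernel

/-! ### The Poisson kernel -/

/-- The probability that a Poisson variable of parameter `x` equals `m`. -/
def poissonKernel (x : ℝ≥0) (m : ℕ) : ℝ := Real.exp (-x) * (x : ℝ) ^ m / m.factorial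

theorem isC0MarkovKernel_poissonKernel : IsC0MarkovKernel poissonKernel where
  nonneg x m := by unfold poissonKernel; positivity
  hasSum_one x := by
    have h := (NormedSpace.expSeries_div_hasSum_exp (x : ℝ)).mul_left (Real.exp (-x))
    rw [← Real.exp_eq_exp_ℝ, ← Real.exp_add, neg_add_cancel, Real.exp_zero] at h
    refine h.congr_fun ?_ |> fun h => h
    intro m
    simp only [poissonKernel, mul_div_assoc]
  continuous m := by unfold poissonKernel; fun_prop
  tendsto_zero m := by
    have h1 := (Real.tendsto_pow_mul_exp_neg_atTop_nhds_zero m).div_const (m.factorial : ℝ)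
    rw [zero_div] at h1
    have h2 : Tendsto (fun x : ℝ≥0 => (x : ℝ)) (cocompact ℝ≥0) atTop := by
      rw [cocompact_eq_atTop]
      exact NNReal.tendsto_coe_atTop.2 tendsto_id
    refine (h1.comp h2).congr fun x => ?_
    simp only [poissonKernel, Function.comp_apply, mul_comm]

/-- The operator `Λ g (x) = 𝔼[g(Pois(x))]` from `c₀(ℤ₊)` to `C₀([0, ∞))`. -/
def poissonOperator : C₀(ℕ, ℝ) →L[ℝ] C₀(ℝ≥0, ℝ) :=
  kernelOperator poissonKernel isC0MarkovKernel_poissonKernel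

theorem poissonOperator_apply (g : C₀(ℕ, ℝ)) (x : ℝ≥0) :
    poissonOperator g x = ∑' m : ℕ, Real.exp (-x) * (x : ℝ) ^ m / m.factorial * g m := rfl

/-! ### Dilations -/

/-- The binomial kernel `𝔻_σ(n, m) = C(n, m) σ^m (1 - σ)^(n - m)`, zero for `m > n`. -/
def binomialKernel (σ : ℝ) (n m : ℕ) : ℝ := n.choose m * σ ^ m * (1 - σ) ^ (n - m)

theorem isC0MarkovKernel_binomialKernel {σ : ℝ} (h0 : 0 < σ) (h1 : σ ≤ 1) :
    IsC0MarkovKernel (binomialKernel σ) where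
  nonneg n m := by
    have : 0 ≤ 1 - σ := by linarith
    unfold binomialKernel; positivity
  hasSum_one n := by
    have h := add_pow σ (1 - σ) n
    rw [add_sub_cancel, one_pow] at h
    rw [h]
    have : ∑ m ∈ Finset.range (n + 1), σ ^ m * (1 - σ) ^ (n - m) * (n.choose m : ℝ)
        = ∑ m ∈ Finset.range (n + 1), binomialKernel σ n m :=
      Finset.sum_congr rfl fun m _ => by unfold binomialKernel; ring
    rw [this]
    refine hasSum_sum_of_ne_finset_zero fun m hm => ?_
    have : n < m := by simpa using hm
    simp [binomialKernel, Nat.choose_eq_zero_of_lt this]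
  continuous m := continuous_of_discreteTopology
  tendsto_zero m := by
    rw [cocompact_eq_cofinite, Nat.cofinite_eq_atTop, ← tendsto_add_atTop_iff_nat m]
    have hq : |1 - σ| < 1 := by rw [abs_lt]; constructor <;> linarith
    have hnn : 0 ≤ 1 - σ := by linarith
    have hlim : Tendsto (fun k : ℕ => ((k + m : ℕ) : ℝ) ^ m * (1 - σ) ^ k) atTop (𝓝 0) := by
      have hb : Tendsto (fun k : ℕ => (2 ^ m : ℝ) * ((k : ℝ) ^ m * (1 - σ) ^ k)) atTop (𝓝 0) := by
        simpa using (tendsto_pow_const_mul_const_pow_of_abs_lt_one m hq).const_mul (2 ^ m : ℝ)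
      refine squeeze_zero' (Eventually.of_forall fun k => by positivity) ?_ hb
      filter_upwards [eventually_ge_atTop m] with k hk
      have hkm : ((k + m : ℕ) : ℝ) ≤ 2 * k := by
        have : ((m : ℕ) : ℝ) ≤ k := by exact_mod_cast hk
        push_cast; linarith
      rw [← mul_assoc, ← mul_pow]
      gcongr
    refine squeeze_zero (fun k => by unfold binomialKernel; positivity) (fun k => ?_) hlim
    unfold binomialKernel
    rw [Nat.add_sub_cancel]
    have hc : ((k + m).choose m : ℝ) ≤ ((k + m : ℕ) : ℝ) ^ m := by
      exact_mod_cast Nat.choose_le_pow (k + m) m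
    have hs : σ ^ m ≤ 1 := pow_le_one₀ h0.le h1
    calc ((k + m).choose m : ℝ) * σ ^ m * (1 - σ) ^ k
        ≤ ((k + m : ℕ) : ℝ) ^ m * 1 * (1 - σ) ^ k := by gcongr
      _ = ((k + m : ℕ) : ℝ) ^ m * (1 - σ) ^ k := by rw [mul_one]

/-- The discrete dilation `𝔻_σ f (n) = ∑_{m ≤ n} f(m) 𝔻_σ(n, m)` on `c₀(ℤ₊)`, `0 < σ ≤ 1`. -/
def discreteDilation (σ : ℝ) (h0 : 0 < σ) (h1 : σ ≤ 1) : C₀(ℕ, ℝ) →L[ℝ] C₀(ℕ, ℝ) :=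
  kernelOperator (binomialKernel σ) (isC0MarkovKernel_binomialKernel h0 h1)

theorem discreteDilation_apply (σ : ℝ) (h0 : 0 < σ) (h1 : σ ≤ 1) (f : C₀(ℕ, ℝ)) (n : ℕ) :
    discreteDilation σ h0 h1 f n
      = ∑ m ∈ Finset.range (n + 1), f m * (n.choose m * σ ^ m * (1 - σ) ^ (n - m)) := by
  change ∑' m, binomialKernel σ n m * f m = _
  rw [tsum_eq_sum (s := Finset.range (n + 1))]
  · exact Finset.sum_congr rfl fun m _ => mul_comm _ _
  · intro m hm
    have : n < m := by simpa using hm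
    simp [binomialKernel, Nat.choose_eq_zero_of_lt this]

/-- The dilation `d_σ f (x) = f (σ x)` on `C₀([0, ∞))`, `σ > 0`. -/
def dilation (σ : ℝ≥0) (h0 : 0 < σ) : C₀(ℝ≥0, ℝ) →L[ℝ] C₀(ℝ≥0, ℝ) :=
  LinearMap.mkContinuous
    { toFun := fun f =>
        { toFun := fun x => f (σ * x)
          continuous_toFun := f.continuous.comp (continuous_const.mul continuous_id)
          zero_at_infty' := f.zero_at_infty'.comp
            (Homeomorph.mulLeft₀ σ h0.ne').isClosedEmbedding.tendsto_cocompact }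
      map_add' := fun _ _ => rfl
      map_smul' := fun _ _ => rfl } 1
    (fun f => by
      rw [one_mul]
      refine (BoundedContinuousFunction.norm_le (norm_nonneg f)).2 fun x => ?_
      exact abs_apply_le_norm f (σ * x))

theorem dilation_apply (σ : ℝ≥0) (h0 : 0 < σ) (f : C₀(ℝ≥0, ℝ)) (x : ℝ≥0) :
    dilation σ h0 f x = f (σ * x) := rfl

/-! ### The Laguerre semigroups -/

/-- The continuous Laguerre semigroup `K_t = Q_{e^t - 1} d_{e^{-t}}` on `C₀([0, ∞))`. -/
def continuousLaguerre (β : ℝ) (t : ℝ≥0) : C₀(ℝ≥0, ℝ) →L[ℝ] C₀(ℝ≥0, ℝ) :=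
  (squaredBessel β (Real.exp t - 1).toNNReal).comp
    (dilation (Real.exp (-t)).toNNReal (Real.toNNReal_pos.2 (Real.exp_pos _)))

/-- The discrete Laguerre semigroup `𝕂_t = ℚ_{e^t - 1} 𝔻_{e^{-t}}` on `c₀(ℤ₊)`. -/
def discreteLaguerre (β : ℝ) (t : ℝ≥0) : C₀(ℕ, ℝ) →L[ℝ] C₀(ℕ, ℝ) :=
  (discreteBessel β (Real.exp t - 1).toNNReal).comp
    (discreteDilation (Real.exp (-t)) (Real.exp_pos _)
      (Real.exp_le_one_iff.2 (neg_nonpos.2 t.2)))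

end Gateway

end

noncomputable section

namespace Gateway

open Filter Topology
open scoped NNReal ZeroAtInfty ContDiff

/-! ### Contraction semigroups and their generators -/

section Semigroup

variable {V : Type*} [NormedAddCommGroup V] [NormedSpace ℝ V]

/-! Everything is read off from two total families: the geometric sequences `geom w`, with values
`(1 - w) ^ n`, and the exponentials `expDecay l`, with values `e^{-l x}`. On them each operator is
explicit. `Λ` sends `geom w` to `expDecay w`, `𝔻_σ` and `d_σ` multiply the parameter by `σ`, and
both Bessel semigroups act by the same rule: the parameter `w` becomes `w / (1 + t w)` and a factor
`(1 + t w) ^ (-β)` appears. Hence `Q_t Λ = Λ ℚ_t` and `d_σ Λ = Λ 𝔻_σ`, which together give the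
intertwining of the Laguerre semigroups. Semigroup identities reduce to algebra with Möbius maps.

The work lies in showing that `squaredBessel` and `discreteBessel`, defined by unique existence, are
given by these formulas.

Existence: `linearBirthDeath` is a binomial thinning composed with a negative binomial pure birth
kernel, so positivity and contractivity are automatic, and its generator at `0` is the sum of the
two generators. `besselFlow` is a Poisson mixture of gamma laws. Its generator on exponentials is
transported from the discrete side by `Λ` and by scaling. It reaches smooth compactly supported
functions through the substitution `u = e^{-x}` and polynomial approximation in `C²([0, 1])`.

Uniqueness: the generator is closed (`hasGenerator_of_approx`), so truncations or cutoffs put `geom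
w` and `expDecay l` in the domain of any competitor. The lines they span are permuted by the
explicit semigroup, and `apply_eq_of_hasGenerator` then forces equality.

For the Laguerre chain, put `τ = e^t - 1`. Since `e^{-t} = 1 / (1 + τ)`, the operator `𝕂_t` is
`linearBirthDeath` at `τ` composed with thinning at `τ`. Thinning contributes a second `n ∂₋`,
whence the death rates `2 n`. -/

/-- `f` is in the domain of the generator of `T`, which maps it to `g`. -/
def HasGenerator (T : ℝ≥0 → V →L[ℝ] V) (f g : V) : Prop :=
  Tendsto (fun t : ℝ≥0 => (t : ℝ)⁻¹ • (T t f - f)) (𝓝[>] 0) (𝓝 g)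

/-- A strongly continuous semigroup of contractions. -/
structure IsContractionSemigroup (T : ℝ≥0 → V →L[ℝ] V) : Prop where
  zero : T 0 = ContinuousLinearMap.id ℝ V
  add : ∀ s t : ℝ≥0, T (s + t) = (T s).comp (T t)
  contraction : ∀ t : ℝ≥0, ‖T t‖ ≤ 1
  tendsto_zero : ∀ f : V, Tendsto (fun t : ℝ≥0 => T t f) (𝓝 0) (𝓝 f)

theorem norm_apply_le_of_norm_le_one {W : Type*} [NormedAddCommGroup W] [NormedSpace ℝ W]
    {A : V →L[ℝ] W} (hA : ‖A‖ ≤ 1) (f : V) : ‖A f‖ ≤ ‖f‖ := by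
  simpa using A.le_of_opNorm_le hA f

theorem HasGenerator.add {T : ℝ≥0 → V →L[ℝ] V} {f f' g g' : V} (h : HasGenerator T f g)
    (h' : HasGenerator T f' g') : HasGenerator T (f + f') (g + g') := by
  refine (Tendsto.add h h').congr fun t => ?_
  rw [← smul_add, map_add]
  congr 1
  abel

theorem HasGenerator.smul {T : ℝ≥0 → V →L[ℝ] V} {f g : V} (h : HasGenerator T f g) (c : ℝ) :
    HasGenerator T (c • f) (c • g) := by
  refine (Tendsto.const_smul h c).congr fun t => ?_
  rw [map_smul, ← smul_sub, smul_comm]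

theorem HasGenerator.zero (T : ℝ≥0 → V →L[ℝ] V) : HasGenerator T 0 0 := by
  simp [HasGenerator]

theorem HasGenerator.sum {ι : Type*} {T : ℝ≥0 → V →L[ℝ] V} {f g : ι → V} (s : Finset ι)
    (h : ∀ i ∈ s, HasGenerator T (f i) (g i)) :
    HasGenerator T (∑ i ∈ s, f i) (∑ i ∈ s, g i) := by
  classical
  induction s using Finset.induction_on with
  | empty => simpa using HasGenerator.zero T
  | insert a s ha ih =>
    rw [Finset.sum_insert ha, Finset.sum_insert ha]
    exact (h a (Finset.mem_insert_self a s)).add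
      (ih fun i hi => h i (Finset.mem_insert_of_mem hi))

theorem HasGenerator.tendsto {T : ℝ≥0 → V →L[ℝ] V} {f g : V} (h : HasGenerator T f g) :
    Tendsto (fun t : ℝ≥0 => T t f) (𝓝[>] 0) (𝓝 f) := by
  have h0 : Tendsto (fun t : ℝ≥0 => (t : ℝ)) (𝓝[>] 0) (𝓝 0) :=
    (NNReal.continuous_coe.tendsto' 0 0 rfl).mono_left nhdsWithin_le_nhds
  have h1 := (h0.smul h).add_const f
  rw [zero_smul, zero_add] at h1
  refine h1.congr' ?_
  filter_upwards [self_mem_nhdsWithin] with t ht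
  have : (t : ℝ) ≠ 0 := NNReal.coe_ne_zero.2 (ne_of_gt ht)
  rw [smul_inv_smul₀ this, sub_add_cancel]

/-- Convergence of uniformly contractive operators on a total set implies strong convergence. -/
theorem tendsto_apply_of_dense_span {W ι : Type*} [NormedAddCommGroup W] [NormedSpace ℝ W]
    {l : Filter ι} {A : ι → V →L[ℝ] W} {B : V →L[ℝ] W} (hA : ∀ i, ‖A i‖ ≤ 1) (hB : ‖B‖ ≤ 1)
    {S : Set V} (hS : Dense (Submodule.span ℝ S : Set V))
    (h : ∀ f ∈ S, Tendsto (fun i => A i f) l (𝓝 (B f))) (f : V) :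
    Tendsto (fun i => A i f) l (𝓝 (B f)) := by
  have hspan : ∀ f ∈ Submodule.span ℝ S, Tendsto (fun i => A i f) l (𝓝 (B f)) := by
    intro f hf
    induction hf using Submodule.span_induction with
    | mem x hx => exact h x hx
    | zero => simpa using tendsto_const_nhds
    | add x y _ _ hx hy => simpa using hx.add hy
    | smul c x _ hx => simpa using hx.const_smul c
  rw [Metric.tendsto_nhds]
  intro ε hε
  obtain ⟨g, hg, hfg⟩ := hS.exists_dist_lt f (show 0 < ε / 3 by positivity)
  filter_upwards [Metric.tendsto_nhds.1 (hspan g hg) (ε / 3) (by positivity)] with i hi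
  have h1 : dist (A i f) (A i g) ≤ dist f g := by
    rw [dist_eq_norm, dist_eq_norm, ← map_sub]
    exact norm_apply_le_of_norm_le_one (hA i) _
  have h2 : dist (B g) (B f) ≤ dist f g := by
    rw [dist_comm f g, dist_eq_norm, dist_eq_norm, ← map_sub]
    exact norm_apply_le_of_norm_le_one hB _
  calc dist (A i f) (B f) ≤ dist (A i f) (A i g) + dist (A i g) (B g) + dist (B g) (B f) :=
        dist_triangle4 _ _ _ _
    _ < ε := by linarith

theorem tendsto_nhds_zero_of_nhdsGT {T : ℝ≥0 → V →L[ℝ] V}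
    (h0 : T 0 = ContinuousLinearMap.id ℝ V) {f : V}
    (h : Tendsto (fun t : ℝ≥0 => T t f) (𝓝[>] 0) (𝓝 f)) :
    Tendsto (fun t : ℝ≥0 => T t f) (𝓝 0) (𝓝 f) := by
  have h1 : (𝓝 (0 : ℝ≥0)) = 𝓝[>] 0 ⊔ pure 0 := by
    rw [← nhdsNE_sup_pure]
    congr 2
    ext x
    simp [pos_iff_ne_zero]
  rw [h1]
  refine h.sup ?_
  rw [tendsto_pure_left]
  intro s hs
  rw [h0]
  exact mem_of_mem_nhds hs

/-- Time changes with unit speed at `0` do not change the generator. -/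
theorem HasGenerator.timeChange {T : ℝ≥0 → V →L[ℝ] V} {f g : V} (h : HasGenerator T f g)
    {τ : ℝ≥0 → ℝ≥0} (hτ : Tendsto τ (𝓝[>] 0) (𝓝[>] 0))
    (hτ' : Tendsto (fun t : ℝ≥0 => (τ t : ℝ) / t) (𝓝[>] 0) (𝓝 1)) :
    HasGenerator (fun t => T (τ t)) f g := by
  have h1 := hτ'.smul (h.comp hτ)
  rw [one_smul] at h1
  refine h1.congr' ?_
  filter_upwards [hτ self_mem_nhdsWithin] with t ht
  have : (τ t : ℝ) ≠ 0 := NNReal.coe_ne_zero.2 (ne_of_gt ht)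
  simp only [Function.comp_apply]
  rw [smul_smul]
  congr 1
  field_simp

/-- A product of two families of contractions has as its generator the sum of the generators. -/
theorem HasGenerator.comp {S T : ℝ≥0 → V →L[ℝ] V} {f g g' : V} (hS : HasGenerator S f g)
    (hT : HasGenerator T f g') (hc : ∀ t, ‖S t‖ ≤ 1)
    (hS0 : ∀ f, Tendsto (fun t : ℝ≥0 => S t f) (𝓝[>] 0) (𝓝 f)) :
    HasGenerator (fun t => (S t).comp (T t)) f (g + g') := by
  -- The quotient for `S t T t` is that of `S t` at `f`, plus `S t g'`, plus `S t` applied to the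
  -- error of the quotient of `T t`. Contractivity makes the last term negligible.
  have h1 : Tendsto (fun t : ℝ≥0 => S t ((t : ℝ)⁻¹ • (T t f - f) - g')) (𝓝[>] 0) (𝓝 0) := by
    refine squeeze_zero_norm (fun t => norm_apply_le_of_norm_le_one (hc t) _) ?_
    have := (Tendsto.sub_const hT g').norm
    rwa [sub_self, norm_zero] at this
  have h2 := (Tendsto.add hS h1).add (hS0 g')
  rw [add_zero] at h2
  refine h2.congr fun t => ?_
  simp only [ContinuousLinearMap.comp_apply, map_sub, map_smul, smul_sub]
  abel

namespace IsContractionSemigroup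

variable {T : ℝ≥0 → V →L[ℝ] V}

theorem norm_apply_le (hT : IsContractionSemigroup T) (t : ℝ≥0) (f : V) : ‖T t f‖ ≤ ‖f‖ :=
  norm_apply_le_of_norm_le_one (hT.contraction t) f

/-- Factoring out the operator at the smaller time reduces continuity at every time to continuity at
`0`. -/
theorem dist_apply_le (hT : IsContractionSemigroup T) (f : V) (s t : ℝ≥0) :
    dist (T s f) (T t f) ≤ dist (T (nndist s t) f) f := by
  wlog hst : t ≤ s generalizing s t
  · rw [dist_comm, nndist_comm]
    exact this t s (le_of_not_ge hst)
  have h1 : nndist s t = s - t := by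
    rw [NNReal.nndist_eq, tsub_eq_zero_of_le hst, max_eq_left zero_le]
  have h2 : T s f = T t (T (s - t) f) := by
    rw [← ContinuousLinearMap.comp_apply, ← hT.add, add_tsub_cancel_of_le hst]
  rw [h1, h2, dist_eq_norm, dist_eq_norm, ← map_sub]
  exact hT.norm_apply_le t _

theorem continuous_apply (hT : IsContractionSemigroup T) (f : V) :
    Continuous fun t : ℝ≥0 => T t f := by
  rw [continuous_iff_continuousAt]
  intro t
  rw [ContinuousAt, tendsto_iff_dist_tendsto_zero]
  refine squeeze_zero (fun _ => dist_nonneg) (fun s => hT.dist_apply_le f s t) ?_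
  rw [← tendsto_iff_dist_tendsto_zero]
  refine (hT.tendsto_zero f).comp ?_
  have : Continuous fun s : ℝ≥0 => nndist s t := by fun_prop
  exact this.tendsto' t 0 (nndist_self t)

theorem continuous_uncurry (hT : IsContractionSemigroup T) :
    Continuous fun p : ℝ≥0 × V => T p.1 p.2 := by
  rw [continuous_iff_continuousAt]
  rintro ⟨t, f⟩
  rw [ContinuousAt, tendsto_iff_dist_tendsto_zero]
  refine squeeze_zero (g := fun p : ℝ≥0 × V => dist p.2 f + dist (T p.1 f) (T t f))
    (fun _ => dist_nonneg) (fun p => ?_) ?_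
  · refine (dist_triangle _ (T p.1 f) _).trans (add_le_add ?_ le_rfl)
    rw [dist_eq_norm, dist_eq_norm, ← map_sub]
    exact hT.norm_apply_le _ _
  · have h := hT.continuous_apply f
    have : Continuous fun p : ℝ≥0 × V => dist p.2 f + dist (T p.1 f) (T t f) := by fun_prop
    exact this.tendsto' _ _ (by simp)

theorem tendsto_toNNReal_sub (s : ℝ) :
    Tendsto (fun r : ℝ => (r - s).toNNReal) (𝓝[>] s) (𝓝[>] 0) := by
  refine tendsto_nhdsWithin_iff.2 ⟨?_, ?_⟩
  · have : Continuous fun r : ℝ => (r - s).toNNReal := by fun_prop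
    exact (this.tendsto' s 0 (by simp)).mono_left nhdsWithin_le_nhds
  · filter_upwards [self_mem_nhdsWithin] with r hr
    exact Real.toNNReal_pos.2 (sub_pos.2 hr)

/-- The increment from `s` to `r > s` is `T s` applied to an increment from time `0`. Right
derivatives suffice for the mean value inequality used next. -/
theorem hasDerivWithinAt (hT : IsContractionSemigroup T) {f g : V} (h : HasGenerator T f g)
    {s : ℝ} (hs : 0 ≤ s) :
    HasDerivWithinAt (fun r : ℝ => T r.toNNReal f) (T s.toNNReal g) (Set.Ici s) s := by
  rw [hasDerivWithinAt_iff_tendsto_slope, Set.Ici_sdiff_left]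
  refine (((T s.toNNReal).continuous.tendsto g).comp
    (Tendsto.comp h (tendsto_toNNReal_sub s))).congr' ?_
  filter_upwards [self_mem_nhdsWithin] with r hr
  have hr' : s < r := hr
  have hadd : r.toNNReal = s.toNNReal + (r - s).toNNReal := by
    rw [← Real.toNNReal_add hs (by linarith), add_sub_cancel]
  simp only [Function.comp_apply, slope_def_module]
  rw [map_smul, map_sub, hadd, hT.add, Real.coe_toNNReal _ (by linarith : 0 ≤ r - s)]
  rfl

/-- This replaces the formula `T t f - f = ∫ T r g dr`. No difference quotient occurs in the bound,
so it survives limits in `f` and `g`. -/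
theorem norm_sub_sub_smul_le (hT : IsContractionSemigroup T) {f g : V} (h : HasGenerator T f g)
    {t : ℝ≥0} {ε : ℝ} (hε : ∀ r ≤ t, ‖T r g - g‖ ≤ ε) :
    ‖T t f - f - (t : ℝ) • g‖ ≤ ε * t := by
  have hcont : ContinuousOn (fun r : ℝ => T r.toNNReal f - r • g) (Set.Icc 0 t) := by
    have := hT.continuous_apply f
    have h2 : Continuous fun r : ℝ => T r.toNNReal f := this.comp continuous_real_toNNReal
    exact (h2.sub (by fun_prop)).continuousOn
  have hder : ∀ r ∈ Set.Ico (0 : ℝ) t, HasDerivWithinAt (fun r : ℝ => T r.toNNReal f - r • g)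
      (T r.toNNReal g - g) (Set.Ici r) r := by
    intro r hr
    have h1 : HasDerivWithinAt (fun r : ℝ => r • g) g (Set.Ici r) r := by
      simpa using ((hasDerivAt_id r).smul_const g).hasDerivWithinAt
    exact (hT.hasDerivWithinAt h hr.1).sub h1
  have := norm_image_sub_le_of_norm_deriv_right_le_segment hcont hder
    (fun r hr => hε _ (by
      rw [Real.toNNReal_le_iff_le_coe]
      exact hr.2.le)) t ⟨t.2, le_rfl⟩
  simp only [Real.toNNReal_coe, Real.toNNReal_zero, zero_smul, sub_zero, hT.zero] at this
  convert this using 2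
  simp only [ContinuousLinearMap.id_apply]
  abel

/-- The generator of a contraction semigroup is closed. -/
theorem hasGenerator_of_approx (hT : IsContractionSemigroup T) {f g : V}
    (h : ∀ ε > 0, ∃ f' g' : V, HasGenerator T f' g' ∧ ‖f' - f‖ ≤ ε ∧ ‖g' - g‖ ≤ ε) :
    HasGenerator T f g := by
  have key : ∀ (t : ℝ≥0) (ε : ℝ), (∀ r ≤ t, ‖T r g - g‖ ≤ ε) →
      ‖T t f - f - (t : ℝ) • g‖ ≤ ε * t := by
    intro t ε hε
    -- Replacing `g` by `g'` inside the hypothesis costs `2 η t`, replacing `f` by `f'` costs `2 η`,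
    -- and the term `t • g` costs `η t`.
    have hb : ∀ η > 0, ‖T t f - f - (t : ℝ) • g‖ ≤ ε * t + η * (3 * t + 2) := by
      intro η hη
      obtain ⟨f', g', hfg, hf, hg⟩ := h η hη
      have h1 : ‖T t f' - f' - (t : ℝ) • g'‖ ≤ (ε + 2 * η) * t := by
        refine hT.norm_sub_sub_smul_le hfg fun r hr => ?_
        have h2 : T r g' - g' = (T r g - g) + T r (g' - g) - (g' - g) := by
          rw [map_sub]; abel
        rw [h2]
        have h3 := norm_sub_le (T r g - g + T r (g' - g)) (g' - g)
        have h4 := norm_add_le (T r g - g) (T r (g' - g))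
        linarith [hε r hr, hT.norm_apply_le r (g' - g)]
      have h2 : T t f - f - (t : ℝ) • g = (T t f' - f' - (t : ℝ) • g')
          - (T t (f' - f) - (f' - f) - (t : ℝ) • (g' - g)) := by
        rw [map_sub, smul_sub]; abel
      rw [h2]
      have h3 := norm_sub_le (T t f' - f' - (t : ℝ) • g')
        (T t (f' - f) - (f' - f) - (t : ℝ) • (g' - g))
      have h4 := norm_sub_le (T t (f' - f) - (f' - f)) ((t : ℝ) • (g' - g))
      have h5 := norm_sub_le (T t (f' - f)) (f' - f)
      have h6 : ‖(t : ℝ) • (g' - g)‖ ≤ t * η := by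
        rw [norm_smul, Real.norm_of_nonneg t.coe_nonneg]
        exact mul_le_mul_of_nonneg_left hg t.2
      have h7 := hT.norm_apply_le t (f' - f)
      nlinarith
    have hlim : Tendsto (fun η : ℝ => ε * t + η * (3 * t + 2)) (𝓝[>] 0) (𝓝 (ε * t)) := by
      have : Continuous fun η : ℝ => ε * t + η * (3 * t + 2) := by fun_prop
      exact (this.tendsto' 0 _ (by simp)).mono_left nhdsWithin_le_nhds
    refine ge_of_tendsto hlim ?_
    filter_upwards [self_mem_nhdsWithin] with η hη using hb η hη
  rw [HasGenerator, Metric.tendsto_nhds]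
  intro ε hε
  obtain ⟨δ, hδ, hδ'⟩ := Metric.tendsto_nhds_nhds.1 (hT.tendsto_zero g) (ε / 2) (by positivity)
  have hmem : Set.Iio (⟨δ, hδ.le⟩ : ℝ≥0) ∈ 𝓝[>] (0 : ℝ≥0) :=
    mem_nhdsWithin_of_mem_nhds (Iio_mem_nhds hδ)
  filter_upwards [self_mem_nhdsWithin, hmem] with t ht htδ
  have ht0 : (0 : ℝ) < t := ht
  have h1 := key t (ε / 2) fun r hr => by
    rw [← dist_eq_norm]
    refine (hδ' ?_).le
    rw [NNReal.dist_eq, NNReal.coe_zero, sub_zero, abs_of_nonneg r.coe_nonneg]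
    exact lt_of_le_of_lt (NNReal.coe_le_coe.2 hr) htδ
  have h2 : (t : ℝ)⁻¹ • (T t f - f) - g = (t : ℝ)⁻¹ • (T t f - f - (t : ℝ) • g) := by
    rw [smul_sub _ (T t f - f), inv_smul_smul₀ ht0.ne']
  rw [dist_eq_norm, h2, norm_smul, norm_inv, Real.norm_of_nonneg ht0.le]
  calc (t : ℝ)⁻¹ * ‖T t f - f - (t : ℝ) • g‖ ≤ (t : ℝ)⁻¹ * (ε / 2 * t) := by gcongr
    _ = ε / 2 := by field_simp
    _ < ε := by linarith

/-- Two semigroups agree at `f` as soon as the generator of the first extends that of the second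
along the orbit of `f` under the second. -/
theorem apply_eq_of_hasGenerator {S : ℝ≥0 → V →L[ℝ] V} (hT : IsContractionSemigroup T)
    (hS : IsContractionSemigroup S) {f : V}
    (h : ∀ s, ∃ g, HasGenerator T (S s f) g ∧ HasGenerator S (S s f) g) (t : ℝ≥0) :
    T t f = S t f := by
  -- The interpolation `r ↦ T (t - r) (S r f)` joins `T t f` to `S t f`. It is constant because its
  -- right derivative vanishes.
  have hcont : ContinuousOn (fun r : ℝ => T (t - r).toNNReal (S r.toNNReal f))
      (Set.Icc 0 t) := by
    have h1 := hT.continuous_uncurry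
    have h2 := hS.continuous_apply f
    have h3 : Continuous fun r : ℝ => S r.toNNReal f := h2.comp continuous_real_toNNReal
    have h4 : Continuous fun r : ℝ => ((t - r).toNNReal, S r.toNNReal f) := by fun_prop
    exact (h1.comp h4).continuousOn
  have hder : ∀ r ∈ Set.Ico (0 : ℝ) t, HasDerivWithinAt
      (fun r : ℝ => T (t - r).toNNReal (S r.toNNReal f)) 0 (Set.Ici r) r := by
    intro s hs
    obtain ⟨g, hTg, hSg⟩ := h s.toNNReal
    rw [hasDerivWithinAt_iff_tendsto_slope, Set.Ici_sdiff_left]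
    have hdiff := ((Tendsto.sub hSg hTg).comp (tendsto_toNNReal_sub s)).norm
    rw [sub_self, norm_zero] at hdiff
    refine squeeze_zero_norm' ?_ hdiff
    have hlt : Set.Iio (t : ℝ) ∈ 𝓝[>] s := mem_nhdsWithin_of_mem_nhds (Iio_mem_nhds hs.2)
    filter_upwards [self_mem_nhdsWithin, hlt] with r hr hrt
    have hr' : s < r := hr
    have hrt' : r < t := hrt
    have e1 : r.toNNReal = (r - s).toNNReal + s.toNNReal := by
      rw [← Real.toNNReal_add (by linarith) hs.1, sub_add_cancel]
    have e2 : (t - s).toNNReal = (t - r).toNNReal + (r - s).toNNReal := by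
      rw [← Real.toNNReal_add (by linarith) (by linarith), sub_add_sub_cancel]
    -- The slope is a contraction applied to the difference of the quotients of `S` and `T` at the
    -- same vector `S s f`. Both quotients have the same limit.
    have e3 : slope (fun r : ℝ => T (t - r).toNNReal (S r.toNNReal f)) s r
        = T (t - r).toNNReal (((r - s).toNNReal : ℝ)⁻¹ •
            (S (r - s).toNNReal (S s.toNNReal f) - S s.toNNReal f)
          - ((r - s).toNNReal : ℝ)⁻¹ •
            (T (r - s).toNNReal (S s.toNNReal f) - S s.toNNReal f)) := by
      rw [slope_def_module, e1, e2, hS.add, hT.add, ← smul_sub, map_smul,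
        Real.coe_toNNReal _ (by linarith : 0 ≤ r - s), sub_sub_sub_cancel_right, map_sub]
      rfl
    rw [e3]
    exact hT.norm_apply_le _ _
  have := constant_of_has_deriv_right_zero hcont hder t ⟨t.2, le_rfl⟩
  simp only [sub_self, Real.toNNReal_zero, Real.toNNReal_coe, sub_zero, hT.zero, hS.zero,
    ContinuousLinearMap.id_apply] at this
  exact this.symm

end IsContractionSemigroup

end Semigroup

/-! ### Feller semigroups -/

section Feller

variable {E : Type*} [TopologicalSpace E]

theorem norm_le_of_abs_le {f : C₀(E, ℝ)} {C : ℝ} (hC : 0 ≤ C) (h : ∀ x, |f x| ≤ C) : ‖f‖ ≤ C :=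
  (BoundedContinuousFunction.norm_le hC).2 h

theorem IsFellerSemigroup.isContractionSemigroup {T : ℝ≥0 → C₀(E, ℝ) →L[ℝ] C₀(E, ℝ)}
    (hT : IsFellerSemigroup T) : IsContractionSemigroup T :=
  ⟨hT.zero, hT.add, hT.contraction, hT.tendsto_zero⟩

theorem generatorMapsTo_iff {T : ℝ≥0 → C₀(E, ℝ) →L[ℝ] C₀(E, ℝ)} {f g : C₀(E, ℝ)} {h : E → ℝ}
    (hg : ∀ x, g x = h x) : GeneratorMapsTo T f h ↔ HasGenerator T f g := by
  constructor
  · rintro ⟨g', hg', H⟩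
    have : g' = g := by
      ext x
      rw [hg, hg']
    rwa [this] at H
  · exact fun H => ⟨g, hg, H⟩

/-- A criterion for Feller semigroups, to be checked on a total set `S` only. -/
theorem IsFellerSemigroup.of_dense_span {T : ℝ≥0 → C₀(E, ℝ) →L[ℝ] C₀(E, ℝ)} {S : Set C₀(E, ℝ)}
    (hS : Dense (Submodule.span ℝ S : Set C₀(E, ℝ)))
    (zero : ∀ f ∈ S, T 0 f = f)
    (add : ∀ s t : ℝ≥0, ∀ f ∈ S, T (s + t) f = T s (T t f))
    (nonneg : ∀ (t : ℝ≥0) (f : C₀(E, ℝ)), (∀ x, 0 ≤ f x) → ∀ x, 0 ≤ T t f x)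
    (contraction : ∀ t : ℝ≥0, ‖T t‖ ≤ 1)
    (mass : ∀ (t : ℝ≥0) (x : E), ∀ c < 1, ∃ f : C₀(E, ℝ),
      (∀ y, 0 ≤ f y) ∧ (∀ y, f y ≤ 1) ∧ c < T t f x)
    {S' : Set C₀(E, ℝ)} (hS' : Dense (Submodule.span ℝ S' : Set C₀(E, ℝ)))
    (tendsto : ∀ f ∈ S', Tendsto (fun t : ℝ≥0 => T t f) (𝓝[>] 0) (𝓝 f)) :
    IsFellerSemigroup T where
  zero := ContinuousLinearMap.ext_on hS fun f hf => by simpa using zero f hf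
  add s t := ContinuousLinearMap.ext_on hS fun f hf => by simpa using add s t f hf
  nonneg := nonneg
  contraction := contraction
  markov t x := by
    constructor
    · rintro r ⟨f, h0, h1, rfl⟩
      have h2 : ‖f‖ ≤ 1 := norm_le_of_abs_le zero_le_one fun y => by
        rw [abs_of_nonneg (h0 y)]
        exact h1 y
      exact (le_abs_self _).trans ((abs_apply_le_norm _ x).trans
        ((norm_apply_le_of_norm_le_one (contraction t) f).trans h2))
    · intro b hb
      by_contra! hlt
      obtain ⟨f, h0, h1, h2⟩ := mass t x b hlt
      exact absurd (hb ⟨f, h0, h1, rfl⟩) (not_le.2 h2)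
  tendsto_zero f := by
    refine tendsto_nhds_zero_of_nhdsGT
      (ContinuousLinearMap.ext_on hS fun f hf => by simpa using zero f hf) ?_
    exact tendsto_apply_of_dense_span (B := ContinuousLinearMap.id ℝ _) contraction
      ContinuousLinearMap.norm_id_le hS' tendsto f

theorem norm_kernelOperator_le {p : E → ℕ → ℝ} (hp : IsC0MarkovKernel p) :
    ‖kernelOperator p hp‖ ≤ 1 :=
  LinearMap.mkContinuous_norm_le _ zero_le_one _

theorem kernelOperator_apply {p : E → ℕ → ℝ} (hp : IsC0MarkovKernel p) (f : C₀(ℕ, ℝ)) (x : E) :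
    kernelOperator p hp f x = ∑' m, p x m * f m := rfl

theorem kernelOperator_nonneg {p : E → ℕ → ℝ} (hp : IsC0MarkovKernel p) {f : C₀(ℕ, ℝ)}
    (hf : ∀ m, 0 ≤ f m) (x : E) : 0 ≤ kernelOperator p hp f x :=
  tsum_nonneg fun m => mul_nonneg (hp.nonneg x m) (hf m)

end Feller

/-! ### The space `c₀(ℤ₊)` -/

/-- A null sequence, as an element of `c₀(ℤ₊)`. -/
def ofNullSequence (f : ℕ → ℝ) (hf : Tendsto f atTop (𝓝 0)) : C₀(ℕ, ℝ) where
  toFun := f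
  continuous_toFun := continuous_of_discreteTopology
  zero_at_infty' := by rwa [cocompact_eq_cofinite, Nat.cofinite_eq_atTop]

@[simp]
theorem ofNullSequence_apply (f : ℕ → ℝ) (hf : Tendsto f atTop (𝓝 0)) (n : ℕ) :
    ofNullSequence f hf n = f n := rfl

theorem tendsto_atTop_zero (f : C₀(ℕ, ℝ)) : Tendsto f atTop (𝓝 0) := by
  have := f.zero_at_infty'
  rwa [cocompact_eq_cofinite, Nat.cofinite_eq_atTop] at this

theorem tendsto_atTop_zero_of_eventually_eq {f : ℕ → ℝ} {N : ℕ} (h : ∀ n ≥ N, f n = 0) :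
    Tendsto f atTop (𝓝 0) :=
  tendsto_const_nhds.congr' (by
    filter_upwards [eventually_ge_atTop N] with n hn using (h n hn).symm)

/-- The indicator of a point of `ℤ₊`. -/
def pointMass (m : ℕ) : C₀(ℕ, ℝ) :=
  ofNullSequence (fun n => if n = m then 1 else 0)
    (tendsto_atTop_zero_of_eventually_eq (N := m + 1) fun n hn => if_neg (by omega))

@[simp]
theorem pointMass_apply (m n : ℕ) : pointMass m n = if n = m then 1 else 0 := rfl

theorem sum_apply {X ι : Type*} [TopologicalSpace X] (s : Finset ι) (f : ι → C₀(X, ℝ)) (x : X) :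
    (∑ i ∈ s, f i) x = ∑ i ∈ s, f i x := by
  classical
  induction s using Finset.induction_on with
  | empty => simp
  | insert a s ha ih => rw [Finset.sum_insert ha, Finset.sum_insert ha, ← ih]; rfl

/-- The restriction of a sequence to `{0, …, N - 1}`. -/
def truncation (N : ℕ) (f : ℕ → ℝ) : C₀(ℕ, ℝ) := ∑ m ∈ Finset.range N, f m • pointMass m

theorem truncation_apply (N : ℕ) (f : ℕ → ℝ) (n : ℕ) :
    truncation N f n = if n < N then f n else 0 := by
  simp [truncation, sum_apply]

theorem support_truncation_finite (N : ℕ) (f : ℕ → ℝ) :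
    (Function.support (truncation N f)).Finite := by
  refine (Finset.range N).finite_toSet.subset fun n hn => ?_
  by_contra h
  simp only [Finset.coe_range, Set.mem_Iio] at h
  exact hn (by rw [truncation_apply, if_neg h])

theorem eq_truncation {f : C₀(ℕ, ℝ)} (hf : (Function.support f).Finite) :
    ∃ N, f = truncation N f := by
  obtain ⟨N, hN⟩ := hf.bddAbove
  refine ⟨N + 1, ?_⟩
  ext n
  rw [truncation_apply]
  split_ifs with h
  · rfl
  · by_contra h0
    have := hN (Function.mem_support.2 h0)
    omega

theorem tendsto_of_pointwise_of_tail {ι : Type*} {l : Filter ι} {F : ι → C₀(ℕ, ℝ)}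
    {g : C₀(ℕ, ℝ)} (N : ℕ) {ε : ι → ℝ} (hpt : ∀ n, Tendsto (fun i => F i n) l (𝓝 (g n)))
    (hε : Tendsto ε l (𝓝 0)) (htail : ∀ᶠ i in l, ∀ n ≥ N, |F i n - g n| ≤ ε i) :
    Tendsto F l (𝓝 g) := by
  rw [tendsto_iff_norm_sub_tendsto_zero]
  have h1 : Tendsto (fun i => ∑ n ∈ Finset.range N, |F i n - g n| + |ε i|) l (𝓝 0) := by
    have h2 : Tendsto (fun i => ∑ n ∈ Finset.range N, |F i n - g n|) l (𝓝 0) := by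
      have := tendsto_finsetSum (Finset.range N) fun n _ => ((hpt n).sub_const (g n)).abs
      simpa using this
    simpa using h2.add hε.abs
  refine squeeze_zero' (Eventually.of_forall fun i => norm_nonneg _) ?_ h1
  filter_upwards [htail] with i hi
  refine norm_le_of_abs_le (by positivity) fun n => ?_
  change |F i n - g n| ≤ _
  by_cases hn : n < N
  · have := Finset.single_le_sum (f := fun n => |F i n - g n|) (fun n _ => abs_nonneg _)
      (Finset.mem_range.2 hn)
    have h3 := abs_nonneg (ε i)
    linarith
  · have h2 : 0 ≤ ∑ n ∈ Finset.range N, |F i n - g n| := Finset.sum_nonneg fun _ _ => abs_nonneg _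
    linarith [hi n (not_lt.1 hn), le_abs_self (ε i)]

theorem dense_span_pointMass :
    Dense (Submodule.span ℝ (Set.range pointMass) : Set C₀(ℕ, ℝ)) := by
  intro f
  rw [Metric.mem_closure_iff]
  intro ε hε
  obtain ⟨N, hN⟩ := Metric.tendsto_atTop.1 (tendsto_atTop_zero f) (ε / 2) (by positivity)
  refine ⟨truncation N f, Submodule.sum_mem _ fun m _ => Submodule.smul_mem _ _
    (Submodule.subset_span ⟨m, rfl⟩), ?_⟩
  rw [dist_eq_norm]
  refine lt_of_le_of_lt (norm_le_of_abs_le (C := ε / 2) (by positivity) fun n => ?_) (by linarith)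
  change |f n - truncation N f n| ≤ _
  rw [truncation_apply]
  split_ifs with h
  · simp; positivity
  · simpa using (hN n (not_lt.1 h)).le

/-! ### Geometric sequences -/

open Classical in
/-- The geometric sequence `n ↦ (1 - w) ^ n`, for `w ∈ (0, 1]`. -/
def geom (w : ℝ) : C₀(ℕ, ℝ) :=
  if h : 0 < w ∧ w ≤ 1 then
    ofNullSequence (fun n => (1 - w) ^ n)
      (tendsto_pow_atTop_nhds_zero_of_lt_one (by linarith [h.2]) (by linarith [h.1]))
  else 0

theorem geom_apply {w : ℝ} (h0 : 0 < w) (h1 : w ≤ 1) (n : ℕ) : geom w n = (1 - w) ^ n := by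
  rw [geom, dif_pos ⟨h0, h1⟩, ofNullSequence_apply]

/-- With `z = 1 - w` small, `geom w` has values `z ^ n`. Removing the coordinates below `m` and
dividing by `z ^ m` leaves the indicator of `m` up to an error at most `z`; the removed coordinates
are covered by induction. -/
theorem pointMass_mem_closure_span_geom (m : ℕ) :
    pointMass m ∈ (Submodule.span ℝ (geom '' Set.Ioo 0 1)).topologicalClosure := by
  induction m using Nat.strong_induction_on with
  | _ m ih =>
    rw [← SetLike.mem_coe, ← (Submodule.isClosed_topologicalClosure _).closure_eq,
      Metric.mem_closure_iff]
    intro ε hε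
    obtain ⟨z, hz0, hz1, hzε⟩ : ∃ z : ℝ, 0 < z ∧ z < 1 ∧ z < ε :=
      ⟨min (1 / 2) (ε / 2), by positivity, by
        linarith [min_le_left (1 / 2 : ℝ) (ε / 2)], by linarith [min_le_right (1 / 2 : ℝ) (ε / 2)]⟩
    refine ⟨(z ^ m)⁻¹ • (geom (1 - z) - ∑ k ∈ Finset.range m, z ^ k • pointMass k), ?_, ?_⟩
    · refine Submodule.smul_mem _ _ (Submodule.sub_mem _ ?_ (Submodule.sum_mem _ fun k hk =>
        Submodule.smul_mem _ _ (ih k (Finset.mem_range.1 hk))))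
      exact Submodule.le_topologicalClosure _ (Submodule.subset_span
        ⟨1 - z, ⟨by linarith, by linarith⟩, rfl⟩)
    · rw [dist_eq_norm]
      refine lt_of_le_of_lt (norm_le_of_abs_le hz0.le fun n => ?_) hzε
      change |pointMass m n - (z ^ m)⁻¹ * (geom (1 - z) n - truncation m (fun k => z ^ k) n)| ≤ z
      rw [geom_apply (by linarith) (by linarith), truncation_apply, pointMass_apply, sub_sub_cancel]
      rcases lt_trichotomy n m with h | h | h
      · simp [h, h.ne, hz0.le]
      · subst h
        simp [hz0.ne', hz0.le]
      · obtain ⟨k, rfl⟩ : ∃ k, n = m + (k + 1) := ⟨n - m - 1, by omega⟩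
        have hzk : z ^ k ≤ 1 := pow_le_one₀ hz0.le hz1.le
        have : (z ^ m)⁻¹ * z ^ (m + (k + 1)) = z ^ k * z := by
          rw [pow_add, pow_succ]; field_simp
        rw [if_neg (by omega), if_neg (by omega), sub_zero, this, zero_sub, abs_neg,
          abs_of_nonneg (by positivity)]
        nlinarith

theorem dense_span_geom :
    Dense (Submodule.span ℝ (geom '' Set.Ioo 0 1) : Set C₀(ℕ, ℝ)) := by
  rw [Submodule.dense_iff_topologicalClosure_eq_top, eq_top_iff]
  have h := Submodule.dense_iff_topologicalClosure_eq_top.1 dense_span_pointMass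
  rw [← h]
  refine Submodule.topologicalClosure_minimal _ (Submodule.span_le.2 ?_)
    (Submodule.isClosed_topologicalClosure _)
  rintro _ ⟨m, rfl⟩
  exact pointMass_mem_closure_span_geom m

/-- This is the generating function of the Poisson law at `1 - w`. -/
theorem poissonOperator_geom {w : ℝ} (h0 : 0 < w) (h1 : w ≤ 1) (x : ℝ≥0) :
    poissonOperator (geom w) x = Real.exp (-(w * x)) := by
  rw [poissonOperator_apply]
  have h := (NormedSpace.expSeries_div_hasSum_exp ((1 - w) * x : ℝ)).mul_left (Real.exp (-x))
  rw [← Real.exp_eq_exp_ℝ, ← Real.exp_add] at h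
  have e : -(x : ℝ) + (1 - w) * x = -(w * x) := by ring
  rw [e] at h
  rw [← h.tsum_eq]
  refine tsum_congr fun m => ?_
  rw [geom_apply h0 h1, mul_pow]
  ring

/-- The generating function of the binomial law at `1 - w` is `(1 - σ w) ^ n`. -/
theorem discreteDilation_geom {σ : ℝ} (h0 : 0 < σ) (h1 : σ ≤ 1) {w : ℝ} (hw0 : 0 < w)
    (hw1 : w ≤ 1) : discreteDilation σ h0 h1 (geom w) = geom (σ * w) := by
  ext n
  rw [discreteDilation_apply, geom_apply (by positivity) (by nlinarith)]
  have h := add_pow (σ * (1 - w)) (1 - σ) n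
  have e : σ * (1 - w) + (1 - σ) = 1 - σ * w := by ring
  rw [e] at h
  rw [h]
  refine Finset.sum_congr rfl fun m _ => ?_
  rw [geom_apply hw0 hw1, mul_pow]
  ring

/-! ### Generators of birth–death type -/

theorem birthDeathOperator_pointMass_eq_zero (b d : ℕ → ℝ) {m n : ℕ} (h : m + 2 ≤ n) :
    birthDeathOperator b d (pointMass m) n = 0 := by
  simp only [birthDeathOperator, pointMass_apply]
  rw [if_neg (by omega), if_neg (by omega), if_neg (by omega)]
  ring

theorem generatorMapsTo_of_pointMass {T : ℝ≥0 → C₀(ℕ, ℝ) →L[ℝ] C₀(ℕ, ℝ)} {b d : ℕ → ℝ}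
    (h : ∀ m, GeneratorMapsTo T (pointMass m) (birthDeathOperator b d (pointMass m)))
    {f : C₀(ℕ, ℝ)} (hf : (Function.support f).Finite) :
    GeneratorMapsTo T f (birthDeathOperator b d f) := by
  choose g hg hTg using h
  obtain ⟨N, hN⟩ := eq_truncation hf
  refine ⟨∑ m ∈ Finset.range N, f m • g m, fun n => ?_, ?_⟩
  · conv_rhs => rw [hN]
    simp only [sum_apply, truncation, birthDeathOperator]
    rw [← Finset.sum_sub_distrib, ← Finset.sum_sub_distrib, Finset.mul_sum, Finset.mul_sum,
      ← Finset.sum_add_distrib]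
    refine Finset.sum_congr rfl fun m _ => ?_
    have e : ∀ k, (f m • pointMass m : C₀(ℕ, ℝ)) k = f m * pointMass m k := fun _ => rfl
    change f m * g m n = _
    rw [hg, birthDeathOperator, e, e, e]
    ring
  · have := HasGenerator.sum (Finset.range N) fun m _ => HasGenerator.smul (hTg m) (f m)
    rw [truncation] at hN
    rwa [← hN] at this

theorem tendsto_coe_nhdsGT_zero : Tendsto (fun t : ℝ≥0 => (t : ℝ)) (𝓝[>] 0) (𝓝[>] 0) :=
  tendsto_nhdsWithin_iff.2 ⟨(NNReal.continuous_coe.tendsto' 0 0 rfl).mono_left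
    nhdsWithin_le_nhds, by filter_upwards [self_mem_nhdsWithin] with t ht using NNReal.coe_pos.2 ht⟩

/-- The difference quotients at `0` of a family of operators on `c₀(ℤ₊)` converge at the indicator
of a point, if they do so pointwise, with a uniform bound at all but finitely many points. -/
theorem generatorMapsTo_pointMass {T : ℝ≥0 → C₀(ℕ, ℝ) →L[ℝ] C₀(ℕ, ℝ)} {b d : ℕ → ℝ} {m : ℕ}
    {C : ℝ} (F : ℕ → ℝ → ℝ) (hT : ∀ t n, T t (pointMass m) n = F n t)
    (hF0 : ∀ n, F n 0 = pointMass m n)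
    (hF : ∀ n, HasDerivAt (F n) (birthDeathOperator b d (pointMass m) n) 0)
    (htail : ∀ᶠ t : ℝ in 𝓝[>] 0, ∀ n ≥ m + 2, |F n t| ≤ C * t ^ 2) :
    GeneratorMapsTo T (pointMass m) (birthDeathOperator b d (pointMass m)) := by
  have hcoe := tendsto_coe_nhdsGT_zero
  refine ⟨ofNullSequence _ (tendsto_atTop_zero_of_eventually_eq (N := m + 2)
    fun n hn => birthDeathOperator_pointMass_eq_zero b d hn), fun n => rfl, ?_⟩
  -- From `m + 2` on the limit is zero, so the bound `C t²` on the operator, divided by `t`,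
  -- controls the whole tail. The remaining coordinates are finitely many.
  refine tendsto_of_pointwise_of_tail (m + 2) (ε := fun t : ℝ≥0 => C * t) (fun n => ?_) ?_ ?_
  · have h := (hF n).tendsto_slope_zero_right.comp hcoe
    refine h.congr fun t => ?_
    simp only [Function.comp_apply, zero_add, hF0]
    change _ = (t : ℝ)⁻¹ * (T t (pointMass m) n - pointMass m n)
    rw [hT, smul_eq_mul]
  · have : Continuous fun t : ℝ≥0 => C * (t : ℝ) := by fun_prop
    exact (this.tendsto' 0 0 (by simp)).mono_left nhdsWithin_le_nhds
  · filter_upwards [hcoe htail, self_mem_nhdsWithin] with t ht ht0 n hn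
    have ht0' : (0 : ℝ) < t := ht0
    change |(t : ℝ)⁻¹ * (T t (pointMass m) n - pointMass m n)
      - birthDeathOperator b d (pointMass m) n| ≤ _
    rw [birthDeathOperator_pointMass_eq_zero b d hn, pointMass_apply, if_neg (by omega), hT,
      sub_zero, sub_zero, abs_mul, abs_inv, abs_of_pos ht0']
    have h1 : |F n t| ≤ C * (t : ℝ) ^ 2 := ht n hn
    calc (t : ℝ)⁻¹ * |F n t| ≤ (t : ℝ)⁻¹ * (C * (t : ℝ) ^ 2) := by gcongr
      _ = C * t := by field_simp

/-- Differentiability at time `0` on point masses already yields strong continuity everywhere, by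
density and contractivity. -/
theorem tendsto_apply_of_generatorMapsTo {T : ℝ≥0 → C₀(ℕ, ℝ) →L[ℝ] C₀(ℕ, ℝ)} {b d : ℕ → ℝ}
    (h : ∀ m, GeneratorMapsTo T (pointMass m) (birthDeathOperator b d (pointMass m)))
    (hc : ∀ t, ‖T t‖ ≤ 1) (f : C₀(ℕ, ℝ)) : Tendsto (fun t => T t f) (𝓝[>] 0) (𝓝 f) := by
  refine tendsto_apply_of_dense_span (B := ContinuousLinearMap.id ℝ _) hc
    ContinuousLinearMap.norm_id_le dense_span_pointMass ?_ f
  rintro _ ⟨m, rfl⟩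
  obtain ⟨g, -, hg⟩ := h m
  exact HasGenerator.tendsto hg

/-- The generator of a linear birth–death chain on geometric sequences. -/
theorem birthDeathOperator_geom (β : ℝ) {w : ℝ} (h0 : 0 < w) (h1 : w ≤ 1) (n : ℕ) :
    birthDeathOperator (fun n => n + β) (fun n => n) (geom w) n
      = w * (n * (1 - w) ^ (n - 1) * w - β * (1 - w) ^ n) := by
  simp only [birthDeathOperator, geom_apply h0 h1]
  rcases n with _ | n
  · simp; ring
  · simp only [Nat.add_sub_cancel, pow_succ]
    ring

theorem tendsto_natCast_add_mul_pow (β : ℝ) {z : ℝ} (hz0 : 0 < z) (hz1 : z < 1) :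
    Tendsto (fun n : ℕ => ((n : ℝ) + β) * z ^ (n - 1)) atTop (𝓝 0) := by
  have h1 := tendsto_self_mul_const_pow_of_lt_one hz0.le hz1
  have h2 := (tendsto_pow_atTop_nhds_zero_of_lt_one hz0.le hz1).const_mul β
  have h3 := (h1.add h2).const_mul z⁻¹
  simp only [mul_zero, add_zero] at h3
  refine h3.congr' ?_
  filter_upwards [eventually_ge_atTop 1] with n hn
  obtain ⟨k, rfl⟩ : ∃ k, n = k + 1 := ⟨n - 1, by omega⟩
  rw [Nat.add_sub_cancel, pow_succ]
  field_simp

/-- The linear growth of the rates is beaten by geometric decay. The bound serves both for `geom w`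
and for its truncation remainders. -/
theorem abs_birthDeathOperator_le {β : ℝ} (hβ : 0 ≤ β) {z : ℝ} (hz0 : 0 < z) (hz1 : z < 1)
    {r : ℕ → ℝ} (hr : ∀ n, |r n| ≤ z ^ n) (n : ℕ) :
    |birthDeathOperator (fun n => n + β) (fun n => n) r n|
      ≤ 4 * (((n : ℝ) + β) * z ^ (n - 1)) := by
  have hz : z ^ n ≤ z ^ (n - 1) := pow_le_pow_of_le_one hz0.le hz1.le (Nat.sub_le n 1)
  have hz' : z ^ (n + 1) ≤ z ^ n := pow_le_pow_of_le_one hz0.le hz1.le (Nat.le_succ n)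
  have h1 : |r (n + 1) - r n| ≤ 2 * z ^ (n - 1) := by
    have := abs_sub (r (n + 1)) (r n)
    linarith [hr n, hr (n + 1)]
  have h2 : |r (n - 1) - r n| ≤ 2 * z ^ (n - 1) := by
    have := abs_sub (r (n - 1)) (r n)
    linarith [hr n, hr (n - 1)]
  have hn : (0 : ℝ) ≤ n := n.cast_nonneg
  unfold birthDeathOperator
  refine (abs_add_le _ _).trans ?_
  rw [abs_mul, abs_mul, abs_of_nonneg (by positivity : (0 : ℝ) ≤ n + β), abs_of_nonneg hn]
  have h3 := mul_le_mul_of_nonneg_left h1 (by positivity : (0 : ℝ) ≤ n + β)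
  have h4 := mul_le_mul_of_nonneg_left h2 hn
  have h5 : 0 ≤ β * z ^ (n - 1) := by positivity
  nlinarith

/-- Geometric sequences are in the domain of the generator of the linear birth–death chain. -/
theorem IsBirthDeathSemigroup.generatorMapsTo_geom {β : ℝ} (hβ : 0 ≤ β)
    {T : ℝ≥0 → C₀(ℕ, ℝ) →L[ℝ] C₀(ℕ, ℝ)}
    (hT : IsBirthDeathSemigroup (fun n => n + β) (fun n => n) T) {w : ℝ} (h0 : 0 < w)
    (h1 : w < 1) :
    GeneratorMapsTo T (geom w) (birthDeathOperator (fun n => n + β) (fun n => n) (geom w)) := by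
  have hz0 : 0 < 1 - w := by linarith
  have hz1 : 1 - w < 1 := by linarith
  have hlim := (tendsto_natCast_add_mul_pow β hz0 hz1).const_mul 4
  rw [mul_zero] at hlim
  have hgeom : ∀ n, |geom w n| ≤ (1 - w) ^ n := fun n => by
    rw [geom_apply h0 h1.le, abs_of_nonneg (by positivity)]
  have hnull : Tendsto (birthDeathOperator (fun n => n + β) (fun n => n) (geom w)) atTop (𝓝 0) :=
    squeeze_zero_norm (fun n => abs_birthDeathOperator_le hβ hz0 hz1 hgeom n) hlim
  refine ⟨ofNullSequence _ hnull, fun n => rfl,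
    hT.feller.isContractionSemigroup.hasGenerator_of_approx fun ε hε => ?_⟩
  obtain ⟨N, hN⟩ := Metric.tendsto_atTop.1 hlim ε hε
  obtain ⟨M, hM⟩ := Metric.tendsto_atTop.1
    (tendsto_pow_atTop_nhds_zero_of_lt_one hz0.le hz1) ε hε
  -- The operator at `n` looks at `n + 1`, so truncating at `N + 1` or beyond leaves no error below
  -- `N`; `M` takes care of the sequence itself.
  set K := max (N + 1) M with hK
  obtain ⟨g, hg, hTg⟩ := hT.generator _ (support_truncation_finite K (geom w))
  have hr : ∀ n, |truncation K (geom w) n - geom w n| ≤ (1 - w) ^ n := fun n => by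
    rw [truncation_apply]
    split_ifs
    · simp; positivity
    · simpa using hgeom n
  have hr0 : ∀ n < K, truncation K (geom w) n - geom w n = 0 := fun n hn => by
    rw [truncation_apply, if_pos hn, sub_self]
  refine ⟨_, g, hTg, norm_le_of_abs_le hε.le fun n => ?_, norm_le_of_abs_le hε.le fun n => ?_⟩
  · change |truncation K (geom w) n - geom w n| ≤ ε
    by_cases hn : n < K
    · rw [hr0 n hn, abs_zero]; exact hε.le
    · refine (hr n).trans ?_
      have := hM n (by omega)
      rw [Real.dist_eq, sub_zero] at this
      exact ((le_abs_self _).trans_lt this).le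
  · change |g n - birthDeathOperator (fun n => n + β) (fun n => n) (geom w) n| ≤ ε
    have e : g n - birthDeathOperator (fun n => n + β) (fun n => n) (geom w) n
        = birthDeathOperator (fun n => n + β) (fun n => n)
          (fun n => truncation K (geom w) n - geom w n) n := by
      rw [hg]
      unfold birthDeathOperator
      ring
    rw [e]
    by_cases hn : n < N
    · unfold birthDeathOperator
      simp only [hr0 n (by omega), hr0 (n + 1) (by omega), hr0 (n - 1) (by omega)]
      simpa using hε.le
    · refine (abs_birthDeathOperator_le hβ hz0 hz1 hr n).trans ?_
      have := hN n (by omega)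
      rw [Real.dist_eq, sub_zero] at this
      exact ((le_abs_self _).trans_lt this).le

/-! ### Thinning and pure birth -/

theorem kernelOperator_pointMass {X : Type*} [TopologicalSpace X] {p : X → ℕ → ℝ}
    (hp : IsC0MarkovKernel p) (m : ℕ) (x : X) : kernelOperator p hp (pointMass m) x = p x m := by
  rw [kernelOperator_apply, tsum_eq_single m]
  · simp
  · intro k hk
    simp [hk]

/-- Thinning and pure birth share this time dependence, `k` being the size of the jump. Only jumps
of size `0` and `1` have a nonzero rate. -/
theorem hasDerivAt_neg_rpow_mul_pow (a : ℝ) (k : ℕ) :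
    HasDerivAt (fun t : ℝ => (1 + t) ^ (-a) * (t / (1 + t)) ^ k)
      (if k = 0 then -a else if k = 1 then 1 else 0) 0 := by
  have h1 : HasDerivAt (fun t : ℝ => 1 + t) 1 0 := (hasDerivAt_id (0 : ℝ)).const_add 1
  have h2 : HasDerivAt (fun t : ℝ => (1 + t) ^ (-a)) (-a) 0 := by
    simpa using h1.rpow_const (p := -a) (Or.inl (by norm_num))
  have h3 : HasDerivAt (fun t : ℝ => t / (1 + t)) 1 0 := by
    refine ((hasDerivAt_id (0 : ℝ)).div h1 (by norm_num)).congr_deriv ?_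
    simp
  refine (h2.mul (h3.pow k)).congr_deriv ?_
  rcases k with _ | _ | k <;> simp

/-- Each of `n` individuals survives with probability `1 / (1 + t)`. -/
def thinning (t : ℝ≥0) : C₀(ℕ, ℝ) →L[ℝ] C₀(ℕ, ℝ) :=
  discreteDilation (1 / (1 + t)) (by positivity)
    (by rw [div_le_one (by positivity)]; linarith [t.coe_nonneg])

theorem norm_thinning_le (t : ℝ≥0) : ‖thinning t‖ ≤ 1 := by
  unfold thinning discreteDilation
  exact norm_kernelOperator_le _

theorem thinning_nonneg (t : ℝ≥0) {f : C₀(ℕ, ℝ)} (hf : ∀ n, 0 ≤ f n) (n : ℕ) :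
    0 ≤ thinning t f n := by
  unfold thinning discreteDilation
  exact kernelOperator_nonneg _ hf n

theorem thinning_geom (t : ℝ≥0) {w : ℝ} (h0 : 0 < w) (h1 : w ≤ 1) :
    thinning t (geom w) = geom (w / (1 + t)) := by
  rw [thinning, discreteDilation_geom _ _ h0 h1]
  congr 1
  ring

theorem thinning_pointMass (t : ℝ≥0) (m n : ℕ) : thinning t (pointMass m) n
    = n.choose m * ((1 + (t : ℝ)) ^ (-(m : ℝ)) * (t / (1 + t)) ^ (n - m)) := by
  have ht : (0 : ℝ) < 1 + t := by positivity
  rw [thinning, discreteDilation, kernelOperator_pointMass, binomialKernel, Real.rpow_neg ht.le,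
    Real.rpow_natCast, one_div, inv_pow, mul_assoc]
  congr 4
  field_simp
  ring

theorem generatorMapsTo_thinning (m : ℕ) : GeneratorMapsTo thinning (pointMass m)
    (birthDeathOperator (fun _ => 0) (fun n => n) (pointMass m)) := by
  refine generatorMapsTo_pointMass (C := 2 ^ (m + 2)) (fun n t => n.choose m *
    ((1 + t) ^ (-(m : ℝ)) * (t / (1 + t)) ^ (n - m))) (fun t n => thinning_pointMass t m n)
    (fun n => ?_) (fun n => ?_) ?_
  · rcases lt_trichotomy n m with h | h | h
    · simp [Nat.choose_eq_zero_of_lt h, h.ne]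
    · simp [h]
    · have : n - m ≠ 0 := by omega
      simp [h.ne', this]
  · refine ((hasDerivAt_neg_rpow_mul_pow m (n - m)).const_mul (n.choose m : ℝ)).congr_deriv ?_
    simp only [birthDeathOperator, pointMass_apply, zero_mul, zero_add]
    rcases lt_trichotomy n m with h | h | h
    · simp [Nat.choose_eq_zero_of_lt h, h.ne, show n - 1 ≠ m by omega]
    · subst h
      rcases n with _ | n <;> simp
    · rw [if_neg (by omega : ¬ n = m), if_neg (by omega : ¬ n - m = 0)]
      by_cases h2 : n = m + 1
      · subst h2
        simp
      · rw [if_neg (by omega), if_neg (by omega)]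
        simp
  · have hmem : Set.Iio (1 / 2 : ℝ) ∈ 𝓝[>] (0 : ℝ) :=
      mem_nhdsWithin_of_mem_nhds (Iio_mem_nhds (by norm_num))
    filter_upwards [self_mem_nhdsWithin, hmem] with t ht0 ht1 n hn
    have ht0' : 0 < t := ht0
    have ht1' : t < 1 / 2 := ht1
    obtain ⟨k, rfl⟩ : ∃ k, n = m + (k + 2) := ⟨n - m - 2, by omega⟩
    rw [Nat.add_sub_cancel_left, abs_of_nonneg (by positivity)]
    have h1 : ((m + (k + 2)).choose m : ℝ) ≤ 2 ^ (m + (k + 2)) := by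
      exact_mod_cast Nat.choose_le_two_pow _ _
    have h2 : (1 + t) ^ (-(m : ℝ)) ≤ 1 :=
      Real.rpow_le_one_of_one_le_of_nonpos (by linarith) (by simp)
    have h3 : t / (1 + t) ≤ t := div_le_self ht0'.le (by linarith)
    calc ((m + (k + 2)).choose m : ℝ) * ((1 + t) ^ (-(m : ℝ)) * (t / (1 + t)) ^ (k + 2))
        ≤ 2 ^ (m + (k + 2)) * (1 * t ^ (k + 2)) := by gcongr
      _ = 2 ^ (m + 2) * t ^ 2 * (2 * t) ^ k := by rw [mul_pow]; ring
      _ ≤ 2 ^ (m + 2) * t ^ 2 * 1 := by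
        gcongr
        exact pow_le_one₀ (by positivity) (by linarith)
      _ = 2 ^ (m + 2) * t ^ 2 := mul_one _

/-! ### Pure birth with immigration: negative binomial kernels -/

theorem multichoose_nonneg {a : ℝ} (ha : 0 ≤ a) (k : ℕ) : 0 ≤ Ring.multichoose a k := by
  have h := Ring.factorial_nsmul_multichoose_eq_ascPochhammer a k
  rw [nsmul_eq_mul, Polynomial.ascPochhammer_smeval_eq_eval] at h
  have h2 : 0 ≤ (ascPochhammer ℝ k).eval a := by
    clear h
    induction k with
    | zero => simp
    | succ k ih => rw [ascPochhammer_succ_eval]; positivity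
  rw [← h] at h2
  exact nonneg_of_mul_nonneg_right h2 (by positivity)

/-- The negative binomial series. -/
theorem hasSum_multichoose_mul_pow (a : ℝ) {y : ℝ} (hy0 : 0 ≤ y) (hy1 : y < 1) :
    HasSum (fun k => Ring.multichoose a k * y ^ k) ((1 - y) ^ (-a)) := by
  have hy : y ∈ Metric.eball (0 : ℝ) 1 := by
    rw [← ENNReal.ofReal_one, Metric.eball_ofReal, Metric.mem_ball, dist_zero_right,
      Real.norm_of_nonneg hy0]
    exact hy1
  have h := (Real.one_div_one_sub_rpow_hasFPowerSeriesOnBall_zero a).hasSum hy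
  rw [zero_add, one_div, ← Real.rpow_neg (by linarith)] at h
  refine h.congr_fun ?_ |> fun h => h
  intro k
  rw [FormalMultilinearSeries.ofScalars_apply_eq, smul_eq_mul, Ring.choose]
  congr 2
  ring

/-- The transition probabilities of the linear pure birth process with immigration. -/
def birthKernel (β : ℝ) (t : ℝ≥0) (n m : ℕ) : ℝ :=
  if n ≤ m then Ring.multichoose (n + β) (m - n) *
    ((1 + (t : ℝ)) ^ (-((n : ℝ) + β)) * (t / (1 + t)) ^ (m - n)) else 0

/-- After the shift by `n` this is the negative binomial series at `t z / (1 + t)`. The case `z = 1`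
gives total mass one, and `z = 1 - w` gives the action on `geom w`. -/
theorem hasSum_birthKernel_mul_pow (β : ℝ) (t : ℝ≥0) (n : ℕ) {z : ℝ} (hz0 : 0 ≤ z)
    (hz1 : z ≤ 1) : HasSum (fun m => birthKernel β t n m * z ^ m)
      (z ^ n * (1 + t * (1 - z)) ^ (-((n : ℝ) + β))) := by
  have ht : (0 : ℝ) < 1 + t := by positivity
  have hy1 : (t : ℝ) / (1 + t) * z < 1 := by
    rw [div_mul_eq_mul_div, div_lt_one ht]
    nlinarith [t.coe_nonneg]
  have h := (hasSum_multichoose_mul_pow ((n : ℝ) + β) (by positivity) hy1).mul_left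
    (z ^ n * (1 + (t : ℝ)) ^ (-((n : ℝ) + β)))
  rw [mul_assoc, ← Real.mul_rpow ht.le (by linarith)] at h
  have e : (1 + (t : ℝ)) * (1 - t / (1 + t) * z) = 1 + t * (1 - z) := by
    field_simp
    ring
  rw [e] at h
  rw [← (add_right_injective n).hasSum_iff]
  · refine h.congr_fun ?_ |> fun h => h
    intro k
    simp only [Function.comp_apply, birthKernel]
    rw [if_pos (Nat.le_add_right n k), Nat.add_sub_cancel_left, pow_add, mul_pow]
    ring
  · intro m hm
    have : ¬ n ≤ m := fun h => hm ⟨m - n, Nat.add_sub_cancel' h⟩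
    rw [birthKernel, if_neg this, zero_mul]

theorem isC0MarkovKernel_birthKernel {β : ℝ} (hβ : 0 ≤ β) (t : ℝ≥0) :
    IsC0MarkovKernel (birthKernel β t) where
  nonneg n m := by
    unfold birthKernel
    split_ifs
    · have := multichoose_nonneg (a := (n : ℝ) + β) (by positivity) (m - n)
      positivity
    · exact le_rfl
  hasSum_one n := by
    simpa using hasSum_birthKernel_mul_pow β t n zero_le_one le_rfl
  continuous m := continuous_of_discreteTopology
  tendsto_zero m := by
    rw [cocompact_eq_cofinite, Nat.cofinite_eq_atTop]
    exact tendsto_atTop_zero_of_eventually_eq (N := m + 1) fun n hn => if_neg (by omega)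

/-- The linear pure birth process with immigration, after a logarithmic time change. -/
def pureBirth {β : ℝ} (hβ : 0 ≤ β) (t : ℝ≥0) : C₀(ℕ, ℝ) →L[ℝ] C₀(ℕ, ℝ) :=
  kernelOperator (birthKernel β t) (isC0MarkovKernel_birthKernel hβ t)

theorem pureBirth_geom {β : ℝ} (hβ : 0 ≤ β) (t : ℝ≥0) {w : ℝ} (h0 : 0 < w) (h1 : w ≤ 1) :
    pureBirth hβ t (geom w) = (1 + t * w) ^ (-β) • geom (w * (1 + t) / (1 + t * w)) := by
  have hpos : (0 : ℝ) < 1 + t * w := by positivity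
  ext n
  change _ = (1 + t * w) ^ (-β) * geom (w * (1 + t) / (1 + t * w)) n
  rw [geom_apply (by positivity) (by rw [div_le_one hpos]; linarith), pureBirth,
    kernelOperator_apply]
  have h := hasSum_birthKernel_mul_pow β t n (z := 1 - w) (by linarith) (by linarith)
  simp only [geom_apply h0 h1]
  rw [h.tsum_eq, sub_sub_cancel, neg_add, Real.rpow_add hpos, Real.rpow_neg hpos.le,
    Real.rpow_natCast]
  have e : 1 - w * (1 + t) / (1 + t * w) = (1 - w) / (1 + t * w) := by
    field_simp
    ring
  rw [e, div_pow]
  field_simp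

theorem generatorMapsTo_pureBirth {β : ℝ} (hβ : 0 ≤ β) (m : ℕ) :
    GeneratorMapsTo (pureBirth hβ) (pointMass m)
      (birthDeathOperator (fun n => n + β) (fun _ => 0) (pointMass m)) := by
  -- The population never decreases, so the kernel vanishes for `n > m` and the tail constant can be
  -- `0`.
  refine generatorMapsTo_pointMass (C := 0) (fun n t => if n ≤ m then
      Ring.multichoose ((n : ℝ) + β) (m - n) *
        ((1 + t) ^ (-((n : ℝ) + β)) * (t / (1 + t)) ^ (m - n)) else 0)
    (fun t n => kernelOperator_pointMass _ m n) (fun n => ?_) (fun n => ?_) ?_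
  · rcases lt_trichotomy n m with h | h | h
    · have : m - n ≠ 0 := by omega
      simp [h.ne, this]
    · simp [h]
    · simp [h.ne', h]
  · simp only [birthDeathOperator, pointMass_apply, zero_mul, add_zero]
    by_cases h : n ≤ m
    · simp only [h, if_true]
      refine ((hasDerivAt_neg_rpow_mul_pow ((n : ℝ) + β) (m - n)).const_mul
        (Ring.multichoose ((n : ℝ) + β) (m - n))).congr_deriv ?_
      rcases h.eq_or_lt with h | h
      · subst h
        simp
      · by_cases h2 : m = n + 1
        · subst h2
          simp
        · rw [if_neg (by omega), if_neg (by omega), if_neg (by omega), if_neg (by omega)]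
          simp
    · simp only [h, if_false]
      rw [if_neg (by omega), if_neg (by omega)]
      simpa using hasDerivAt_const (0 : ℝ) (0 : ℝ)
  · refine Eventually.of_forall fun t n hn => ?_
    rw [if_neg (by omega)]
    simp

/-! ### The linear birth–death semigroup -/

/-- The semigroup of the linear birth–death chain with birth rates `n + β` and death rates `n`. -/
def linearBirthDeath {β : ℝ} (hβ : 0 ≤ β) (t : ℝ≥0) : C₀(ℕ, ℝ) →L[ℝ] C₀(ℕ, ℝ) :=
  (thinning t).comp (pureBirth hβ t)

/-- The factor `1 + t` gained by pure birth is cancelled by thinning. What remains translates `1 /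
w` by `t`, which is the source of the semigroup property. -/
theorem linearBirthDeath_geom {β : ℝ} (hβ : 0 ≤ β) (t : ℝ≥0) {w : ℝ} (h0 : 0 < w) (h1 : w ≤ 1) :
    linearBirthDeath hβ t (geom w) = (1 + t * w) ^ (-β) • geom (w / (1 + t * w)) := by
  have hpos : (0 : ℝ) < 1 + t * w := by positivity
  rw [linearBirthDeath, ContinuousLinearMap.comp_apply, pureBirth_geom hβ t h0 h1, map_smul,
    thinning_geom t (by positivity) (by rw [div_le_one hpos]; linarith)]
  congr 2
  field_simp

theorem norm_comp_le_one {U V W : Type*} [NormedAddCommGroup U] [NormedSpace ℝ U]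
    [NormedAddCommGroup V] [NormedSpace ℝ V] [NormedAddCommGroup W] [NormedSpace ℝ W]
    {A : V →L[ℝ] W} {B : U →L[ℝ] V} (hA : ‖A‖ ≤ 1) (hB : ‖B‖ ≤ 1) : ‖A.comp B‖ ≤ 1 :=
  (A.opNorm_comp_le B).trans (mul_le_one₀ hA (norm_nonneg B) hB)

theorem norm_linearBirthDeath_le {β : ℝ} (hβ : 0 ≤ β) (t : ℝ≥0) : ‖linearBirthDeath hβ t‖ ≤ 1 :=
  norm_comp_le_one (norm_thinning_le t) (norm_kernelOperator_le _)

theorem linearBirthDeath_nonneg {β : ℝ} (hβ : 0 ≤ β) (t : ℝ≥0) {f : C₀(ℕ, ℝ)}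
    (hf : ∀ n, 0 ≤ f n) (n : ℕ) : 0 ≤ linearBirthDeath hβ t f n :=
  thinning_nonneg t (kernelOperator_nonneg _ hf) n

/-- Generators of products of two families of birth–death type. -/
theorem generatorMapsTo_comp {S T : ℝ≥0 → C₀(ℕ, ℝ) →L[ℝ] C₀(ℕ, ℝ)} {b b' d d' b'' d'' : ℕ → ℝ}
    (hS : ∀ m, GeneratorMapsTo S (pointMass m) (birthDeathOperator b d (pointMass m)))
    (hT : ∀ m, GeneratorMapsTo T (pointMass m) (birthDeathOperator b' d' (pointMass m)))
    (hc : ∀ t, ‖S t‖ ≤ 1) (hb : ∀ n, b'' n = b n + b' n) (hd : ∀ n, d'' n = d n + d' n) (m : ℕ) :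
    GeneratorMapsTo (fun t => (S t).comp (T t)) (pointMass m)
      (birthDeathOperator b'' d'' (pointMass m)) := by
  obtain ⟨g, hg, hSg⟩ := hS m
  obtain ⟨g', hg', hTg⟩ := hT m
  refine ⟨g + g', fun n => ?_,
    HasGenerator.comp hSg hTg hc (tendsto_apply_of_generatorMapsTo hS hc)⟩
  change g n + g' n = _
  rw [hg, hg']
  unfold birthDeathOperator
  rw [hb, hd]
  ring

/-- Neither factor needs to be a semigroup in this parametrization: only the derivatives at `0` of
the two families enter, and they add up. -/
theorem generatorMapsTo_linearBirthDeath {β : ℝ} (hβ : 0 ≤ β) (m : ℕ) :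
    GeneratorMapsTo (linearBirthDeath hβ) (pointMass m)
      (birthDeathOperator (fun n => n + β) (fun n => n) (pointMass m)) :=
  generatorMapsTo_comp generatorMapsTo_thinning (generatorMapsTo_pureBirth hβ) norm_thinning_le
    (fun n => by simp) (fun n => by simp) m

/-- A criterion for a family of operators acting on geometric sequences by a flow and a
multiplicative cocycle to be a birth–death semigroup. -/
theorem isBirthDeathSemigroup_of_geom {T : ℝ≥0 → C₀(ℕ, ℝ) →L[ℝ] C₀(ℕ, ℝ)} {b d : ℕ → ℝ}
    (hb : ∀ n, 0 ≤ b n) (hd : ∀ n, 0 ≤ d n) (hd0 : d 0 = 0)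
    (hgen : ∀ m, GeneratorMapsTo T (pointMass m) (birthDeathOperator b d (pointMass m)))
    (hc : ∀ t, ‖T t‖ ≤ 1) (hnn : ∀ t f, (∀ n, 0 ≤ f n) → ∀ n, 0 ≤ T t f n)
    (a φ : ℝ≥0 → ℝ → ℝ)
    (hT : ∀ t, ∀ w ∈ Set.Ioo (0 : ℝ) 1, T t (geom w) = a t w • geom (φ t w))
    (hφ : ∀ t, ∀ w ∈ Set.Ioo (0 : ℝ) 1, φ t w ∈ Set.Ioo (0 : ℝ) 1)
    (ha0 : ∀ w ∈ Set.Ioo (0 : ℝ) 1, a 0 w = 1) (hφ0 : ∀ w ∈ Set.Ioo (0 : ℝ) 1, φ 0 w = w)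
    (ha : ∀ s t, ∀ w ∈ Set.Ioo (0 : ℝ) 1, a (s + t) w = a t w * a s (φ t w))
    (hφs : ∀ s t, ∀ w ∈ Set.Ioo (0 : ℝ) 1, φ (s + t) w = φ s (φ t w))
    (ha' : ∀ t, Tendsto (a t) (𝓝[>] 0) (𝓝 1)) (hφ' : ∀ t, Tendsto (φ t) (𝓝[>] 0) (𝓝 0)) :
    IsBirthDeathSemigroup b d T where
  birth_nonneg := hb
  death_nonneg := hd
  death_zero := hd0
  generator f hf := generatorMapsTo_of_pointMass hgen hf
  feller := by
    refine IsFellerSemigroup.of_dense_span dense_span_geom ?_ ?_ hnn hc ?_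
      dense_span_pointMass fun f _ => tendsto_apply_of_generatorMapsTo hgen hc f
    · rintro _ ⟨w, hw, rfl⟩
      rw [hT 0 w hw, ha0 w hw, hφ0 w hw, one_smul]
    · rintro s t _ ⟨w, hw, rfl⟩
      rw [hT _ w hw, hT _ w hw, map_smul, hT s _ (hφ t w hw), ha s t w hw, hφs s t w hw, mul_smul]
    · intro t n c hclt
      -- As `w` decreases to `0`, `geom w` increases to the constant `1`, so its images exhaust the
      -- mass of the transition probability.
      have hlim : Tendsto (fun w => a t w * (1 - φ t w) ^ n) (𝓝[>] 0) (𝓝 1) := by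
        simpa using (ha' t).mul (((hφ' t).const_sub 1).pow n)
      have hmem : Set.Iio (1 : ℝ) ∈ 𝓝[>] (0 : ℝ) :=
        mem_nhdsWithin_of_mem_nhds (Iio_mem_nhds one_pos)
      obtain ⟨w, hw, hw1, hw0⟩ := ((hlim.eventually (lt_mem_nhds hclt)).and
        ((eventually_mem_set.2 hmem).and self_mem_nhdsWithin)).exists
      have hw' : w ∈ Set.Ioo (0 : ℝ) 1 := ⟨hw0, hw1⟩
      have h0 : 0 ≤ 1 - w := sub_nonneg.2 hw'.2.le
      refine ⟨geom w, fun k => ?_, fun k => ?_, ?_⟩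
      · rw [geom_apply hw'.1 hw'.2.le]
        positivity
      · rw [geom_apply hw'.1 hw'.2.le]
        exact pow_le_one₀ h0 (by linarith [hw'.1])
      · rw [hT t w hw']
        change c < a t w * geom (φ t w) n
        rwa [geom_apply (hφ t w hw').1 (hφ t w hw').2.le]

theorem tendsto_one_add_mul_rpow (c b : ℝ) :
    Tendsto (fun w : ℝ => (1 + c * w) ^ b) (𝓝[>] 0) (𝓝 1) := by
  have h : ContinuousAt (fun w : ℝ => (1 + c * w) ^ b) 0 :=
    ContinuousAt.rpow_const (by fun_prop) (Or.inl (by simp))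
  have h2 := h.tendsto
  simp only [mul_zero, add_zero, Real.one_rpow] at h2
  exact h2.mono_left nhdsWithin_le_nhds

theorem tendsto_div_one_add_mul (c : ℝ) :
    Tendsto (fun w : ℝ => w / (1 + c * w)) (𝓝[>] 0) (𝓝 0) := by
  have h : ContinuousAt (fun w : ℝ => w / (1 + c * w)) 0 :=
    ContinuousAt.div (by fun_prop) (by fun_prop) (by simp)
  have h2 := h.tendsto
  simp only [zero_div] at h2
  exact h2.mono_left nhdsWithin_le_nhds

theorem isBirthDeathSemigroup_linearBirthDeath {β : ℝ} (hβ : 0 ≤ β) :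
    IsBirthDeathSemigroup (fun n => n + β) (fun n => n) (linearBirthDeath hβ) := by
  refine isBirthDeathSemigroup_of_geom (fun n => by positivity) (fun n => by positivity)
    (by simp) (generatorMapsTo_linearBirthDeath hβ) (norm_linearBirthDeath_le hβ)
    (fun t f hf => linearBirthDeath_nonneg hβ t hf)
    (fun t w => (1 + t * w) ^ (-β)) (fun t w => w / (1 + t * w))
    (fun t w hw => linearBirthDeath_geom hβ t hw.1 hw.2.le) ?_ (fun w _ => by simp)
    (fun w _ => by simp) ?_ ?_ (fun t => tendsto_one_add_mul_rpow t (-β))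
    (fun t => tendsto_div_one_add_mul t)
  · rintro t w ⟨h0, h1⟩
    refine ⟨by positivity, ?_⟩
    rw [div_lt_one (by positivity)]
    nlinarith [mul_nonneg t.coe_nonneg h0.le]
  · rintro s t w ⟨h0, h1⟩
    rw [← Real.mul_rpow (by positivity) (by positivity)]
    congr 1
    push_cast
    field_simp
    ring
  · rintro s t w ⟨h0, h1⟩
    push_cast
    field_simp
    ring

/-- The orbit of `geom w` under `linearBirthDeath` consists of multiples of geometric sequences.
These lie in the domain of every semigroup with the same rates, with the same image under the
generator. -/
theorem IsBirthDeathSemigroup.eq_linearBirthDeath {β : ℝ} (hβ : 0 ≤ β)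
    {T : ℝ≥0 → C₀(ℕ, ℝ) →L[ℝ] C₀(ℕ, ℝ)}
    (hT : IsBirthDeathSemigroup (fun n => n + β) (fun n => n) T) : T = linearBirthDeath hβ := by
  have hS := isBirthDeathSemigroup_linearBirthDeath hβ
  funext t
  refine ContinuousLinearMap.ext_on dense_span_geom ?_
  rintro _ ⟨w, ⟨h0, h1⟩, rfl⟩
  refine hT.feller.isContractionSemigroup.apply_eq_of_hasGenerator
    hS.feller.isContractionSemigroup (fun s => ?_) t
  have hw1 : w / (1 + s * w) < 1 := by
    rw [div_lt_one (by positivity)]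
    nlinarith [mul_nonneg s.coe_nonneg h0.le]
  obtain ⟨g, hg, hTg⟩ := hT.generatorMapsTo_geom hβ (by positivity) hw1
  have hSg := (generatorMapsTo_iff hg).1 (hS.generatorMapsTo_geom hβ (by positivity) hw1)
  rw [linearBirthDeath_geom hβ s h0 h1.le]
  exact ⟨_, HasGenerator.smul hTg _, HasGenerator.smul hSg _⟩

theorem discreteBessel_eq {β : ℝ} (hβ : 0 ≤ β) : discreteBessel β = linearBirthDeath hβ := by
  have h : ∃! T, IsBirthDeathSemigroup (fun n => n + β) (fun n => n) T :=
    ⟨linearBirthDeath hβ, isBirthDeathSemigroup_linearBirthDeath hβ,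
      fun T hT => IsBirthDeathSemigroup.eq_linearBirthDeath hβ hT⟩
  rw [discreteBessel, dif_pos h]
  exact IsBirthDeathSemigroup.eq_linearBirthDeath hβ h.choose_spec.1

/-! ### The discrete Laguerre semigroup -/

/-- The time change `t ↦ e^t - 1`. -/
def expSubOne (t : ℝ≥0) : ℝ≥0 := (Real.exp t - 1).toNNReal

theorem coe_expSubOne (t : ℝ≥0) : (expSubOne t : ℝ) = Real.exp t - 1 :=
  Real.coe_toNNReal _ (by linarith [Real.add_one_le_exp (t : ℝ), t.coe_nonneg])

theorem one_add_expSubOne (t : ℝ≥0) : 1 + (expSubOne t : ℝ) = Real.exp t := by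
  rw [coe_expSubOne]; ring

theorem tendsto_expSubOne : Tendsto expSubOne (𝓝[>] 0) (𝓝[>] 0) := by
  refine tendsto_nhdsWithin_iff.2 ⟨?_, ?_⟩
  · have : Continuous expSubOne := by unfold expSubOne; fun_prop
    exact (this.tendsto' 0 0 (by simp [expSubOne])).mono_left nhdsWithin_le_nhds
  · filter_upwards [self_mem_nhdsWithin] with t ht
    have ht' : (0 : ℝ) < t := ht
    rw [Set.mem_Ioi, ← NNReal.coe_pos, coe_expSubOne]
    linarith [Real.add_one_le_exp (t : ℝ)]

theorem tendsto_expSubOne_div :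
    Tendsto (fun t : ℝ≥0 => (expSubOne t : ℝ) / t) (𝓝[>] 0) (𝓝 1) := by
  have h := (Real.hasDerivAt_exp 0).tendsto_slope_zero_right.comp tendsto_coe_nhdsGT_zero
  rw [Real.exp_zero] at h
  refine h.congr fun t => ?_
  rw [coe_expSubOne, Function.comp_apply, zero_add, smul_eq_mul, div_eq_inv_mul]

theorem discreteDilation_exp_neg (t : ℝ≥0) (h0 : 0 < Real.exp (-t)) (h1 : Real.exp (-t) ≤ 1) :
    discreteDilation (Real.exp (-t)) h0 h1 = thinning (expSubOne t) := by
  unfold thinning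
  congr 1
  rw [one_add_expSubOne, Real.exp_neg, one_div]

theorem discreteLaguerre_eq {β : ℝ} (hβ : 0 ≤ β) (t : ℝ≥0) : discreteLaguerre β t
    = (linearBirthDeath hβ (expSubOne t)).comp (thinning (expSubOne t)) := by
  rw [discreteLaguerre, discreteBessel_eq hβ, discreteDilation_exp_neg]
  rfl

theorem discreteLaguerre_geom {β : ℝ} (hβ : 0 ≤ β) (t : ℝ≥0) {w : ℝ} (h0 : 0 < w) (h1 : w ≤ 1) :
    discreteLaguerre β t (geom w) = (1 + (1 - Real.exp (-t)) * w) ^ (-β) •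
      geom (Real.exp (-t) * w / (1 + (1 - Real.exp (-t)) * w)) := by
  have he : (1 : ℝ) ≤ Real.exp t := Real.one_le_exp t.coe_nonneg
  rw [discreteLaguerre_eq hβ, ContinuousLinearMap.comp_apply, thinning_geom _ h0 h1,
    one_add_expSubOne, linearBirthDeath_geom hβ _ (by positivity)
      (by rw [div_le_one (by positivity)]; linarith), coe_expSubOne, Real.exp_neg]
  congr 2 <;> field_simp

/-- One `n ∂₋` comes from the linear birth–death chain and one from thinning. The time change has
unit speed at `0` and leaves the sum unaltered. -/
theorem generatorMapsTo_discreteLaguerre {β : ℝ} (hβ : 0 ≤ β) (m : ℕ) :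
    GeneratorMapsTo (discreteLaguerre β) (pointMass m)
      (birthDeathOperator (fun n => n + β) (fun n => 2 * n) (pointMass m)) := by
  obtain ⟨g, hg, h⟩ := generatorMapsTo_comp (b'' := fun n => n + β) (d'' := fun n => 2 * n)
    (generatorMapsTo_linearBirthDeath hβ) generatorMapsTo_thinning (norm_linearBirthDeath_le hβ)
    (fun n => by simp) (fun n => by ring) m
  refine ⟨g, hg, ?_⟩
  have h2 := HasGenerator.timeChange h tendsto_expSubOne tendsto_expSubOne_div
  simp only [← discreteLaguerre_eq hβ] at h2
  exact h2

/-- The discrete Laguerre semigroup is the semigroup of the birth–death chain with birth rates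
`n + β` and death rates `2 n`. -/
theorem isBirthDeathSemigroup_discreteLaguerre {β : ℝ} (hβ : 0 ≤ β) :
    IsBirthDeathSemigroup (fun n => n + β) (fun n => 2 * n) (discreteLaguerre β) := by
  refine isBirthDeathSemigroup_of_geom (fun n => by positivity) (fun n => by positivity)
    (by simp) (generatorMapsTo_discreteLaguerre hβ) (fun t => ?_) (fun t f hf n => ?_)
    (fun t w => (1 + (1 - Real.exp (-t)) * w) ^ (-β))
    (fun t w => Real.exp (-t) * w / (1 + (1 - Real.exp (-t)) * w))
    (fun t w hw => discreteLaguerre_geom hβ t hw.1 hw.2.le) ?_ (fun w _ => by simp)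
    (fun w _ => by simp) ?_ ?_ (fun t => tendsto_one_add_mul_rpow _ (-β)) (fun t => ?_)
  · rw [discreteLaguerre_eq hβ]
    exact norm_comp_le_one (norm_linearBirthDeath_le hβ _) (norm_thinning_le _)
  · rw [discreteLaguerre_eq hβ]
    exact linearBirthDeath_nonneg hβ _ (thinning_nonneg _ hf) n
  · rintro t w ⟨h0, h1⟩
    have he : Real.exp (-t) ≤ 1 := Real.exp_le_one_iff.2 (by simp)
    have he' : 0 ≤ 1 - Real.exp (-t) := by linarith
    refine ⟨by positivity, ?_⟩
    rw [div_lt_one (by positivity)]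
    nlinarith [Real.exp_pos (-t)]
  · rintro s t w ⟨h0, h1⟩
    have he : 0 ≤ 1 - Real.exp (-t) := by
      linarith [Real.exp_le_one_iff.2 (by simp : -(t : ℝ) ≤ 0)]
    have he' : 0 ≤ 1 - Real.exp (-s) := by
      linarith [Real.exp_le_one_iff.2 (by simp : -(s : ℝ) ≤ 0)]
    have hp : 0 < 1 + (1 - Real.exp (-t)) * w := by positivity
    rw [← Real.mul_rpow hp.le (by positivity)]
    congr 1
    push_cast
    rw [neg_add, Real.exp_add]
    field_simp
    ring
  · rintro s t w ⟨h0, h1⟩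
    have he : 0 ≤ 1 - Real.exp (-t) := by
      linarith [Real.exp_le_one_iff.2 (by simp : -(t : ℝ) ≤ 0)]
    have he' : 0 ≤ 1 - Real.exp (-s) := by
      linarith [Real.exp_le_one_iff.2 (by simp : -(s : ℝ) ≤ 0)]
    have hp : 0 < 1 + (1 - Real.exp (-t)) * w := by positivity
    have hp' : 0 < 1 + (1 - Real.exp (-s)) *
        (Real.exp (-t) * w / (1 + (1 - Real.exp (-t)) * w)) := by
      positivity
    have e : (1 + (1 - Real.exp (-s)) * (Real.exp (-t) * w / (1 + (1 - Real.exp (-t)) * w)))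
        = (1 + (1 - Real.exp (-s) * Real.exp (-t)) * w) / (1 + (1 - Real.exp (-t)) * w) := by
      field_simp
      ring
    push_cast
    rw [neg_add, Real.exp_add, e]
    field_simp
  · have := (tendsto_div_one_add_mul (1 - Real.exp (-t))).const_mul (Real.exp (-t))
    simpa only [mul_zero, ← mul_div_assoc] using this

/-! ### The space `C₀([0, ∞))` -/

/-- A continuous function on `[0, ∞)` vanishing at infinity, as an element of `C₀([0, ∞))`. -/
def ofTendstoAtTop (f : ℝ≥0 → ℝ) (hf : Continuous f) (h : Tendsto f atTop (𝓝 0)) :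
    C₀(ℝ≥0, ℝ) where
  toFun := f
  continuous_toFun := hf
  zero_at_infty' := by rwa [cocompact_eq_atTop]

@[simp]
theorem ofTendstoAtTop_apply (f : ℝ≥0 → ℝ) (hf : Continuous f) (h : Tendsto f atTop (𝓝 0))
    (x : ℝ≥0) : ofTendstoAtTop f hf h x = f x := rfl

theorem tendsto_atTop_zero_nnreal (f : C₀(ℝ≥0, ℝ)) : Tendsto f atTop (𝓝 0) := by
  have := f.zero_at_infty'
  rwa [cocompact_eq_atTop] at this

theorem tendsto_one_add_mul_exp_neg {l : ℝ} (hl : 0 < l) :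
    Tendsto (fun x : ℝ≥0 => (1 + (x : ℝ)) * Real.exp (-(l * x))) atTop (𝓝 0) := by
  have h1 : Tendsto (fun y : ℝ => y * Real.exp (-y)) atTop (𝓝 0) := by
    simpa using Real.tendsto_pow_mul_exp_neg_atTop_nhds_zero 1
  have h0 : Tendsto (fun y : ℝ => Real.exp (-y)) atTop (𝓝 0) := by
    simpa using Real.tendsto_pow_mul_exp_neg_atTop_nhds_zero 0
  have h2 : Tendsto (fun x : ℝ≥0 => l * (x : ℝ)) atTop atTop :=
    (NNReal.tendsto_coe_atTop.2 tendsto_id).const_mul_atTop hl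
  have h3 := (h0.comp h2).add ((h1.comp h2).const_mul l⁻¹)
  simp only [mul_zero, add_zero] at h3
  refine h3.congr fun x => ?_
  simp only [Function.comp_apply]
  field_simp

theorem tendsto_exp_neg_mul {l : ℝ} (hl : 0 < l) :
    Tendsto (fun x : ℝ≥0 => Real.exp (-(l * x))) atTop (𝓝 0) := by
  refine squeeze_zero (fun x => (Real.exp_pos _).le) (fun x => ?_) (tendsto_one_add_mul_exp_neg hl)
  have := Real.exp_pos (-(l * x))
  nlinarith [x.coe_nonneg]

open Classical in
/-- The exponential function `x ↦ e^{-l x}`, for `l > 0`. -/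
def expDecay (l : ℝ) : C₀(ℝ≥0, ℝ) :=
  if h : 0 < l then
    ofTendstoAtTop (fun x => Real.exp (-(l * x))) (by fun_prop) (tendsto_exp_neg_mul h)
  else 0

theorem expDecay_apply {l : ℝ} (h : 0 < l) (x : ℝ≥0) : expDecay l x = Real.exp (-(l * x)) := by
  rw [expDecay, dif_pos h, ofTendstoAtTop_apply]

/-- The function `x ↦ p(e^{-x})`, for a polynomial `p` without constant term. -/
def polyExp (p : Polynomial ℝ) : C₀(ℝ≥0, ℝ) :=
  p.sum fun k c => c • expDecay k

theorem polyExp_apply {p : Polynomial ℝ} (hp : p.eval 0 = 0) (x : ℝ≥0) :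
    polyExp p x = p.eval (Real.exp (-x)) := by
  have h0 : p.coeff 0 = 0 := by rwa [Polynomial.coeff_zero_eq_eval_zero]
  rw [polyExp, Polynomial.sum, sum_apply, Polynomial.eval_eq_sum, Polynomial.sum]
  refine Finset.sum_congr rfl fun k hk => ?_
  have hk0 : k ≠ 0 := fun h => by
    rw [h, Polynomial.mem_support_iff] at hk
    exact hk h0
  change p.coeff k * expDecay k x = _
  rw [expDecay_apply (by positivity), ← Real.exp_nat_mul]
  congr 2
  ring

theorem polyExp_mem_span {p : Polynomial ℝ} (hp : p.eval 0 = 0) :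
    polyExp p ∈ Submodule.span ℝ (expDecay '' Set.Ioi 0) := by
  have h0 : p.coeff 0 = 0 := by rwa [Polynomial.coeff_zero_eq_eval_zero]
  refine Submodule.sum_mem _ fun k hk => Submodule.smul_mem _ _ (Submodule.subset_span ⟨k, ?_, rfl⟩)
  have hk0 : k ≠ 0 := fun h => by
    rw [h, Polynomial.mem_support_iff] at hk
    exact hk h0
  exact Set.mem_Ioi.2 (by positivity)

/-- The substitution `u = e^{-x}` turns `C₀([0, ∞))` into the continuous functions on `[0, 1]`
vanishing at `0`, where the Weierstrass theorem applies. -/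
theorem dense_span_expDecay :
    Dense (Submodule.span ℝ (expDecay '' Set.Ioi 0) : Set C₀(ℝ≥0, ℝ)) := by
  intro f
  rw [Metric.mem_closure_iff]
  intro ε hε
  set ψ : ℝ → ℝ := fun u => if 0 < u then f (-Real.log u).toNNReal else 0 with hψ
  have hψc : ContinuousOn ψ (Set.Icc 0 1) := by
    intro u hu
    refine ContinuousAt.continuousWithinAt ?_
    rcases hu.1.eq_or_lt with rfl | hu0
    · have h0 : ψ 0 = 0 := by simp [hψ]
      rw [ContinuousAt, h0, Metric.tendsto_nhds]
      intro δ hδ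
      have hlog : Tendsto (fun u : ℝ => (-Real.log u).toNNReal) (𝓝[>] 0) atTop := by
        have h1 : Tendsto (fun u : ℝ => -Real.log u) (𝓝[>] 0) atTop :=
          tendsto_neg_atBot_atTop.comp Real.tendsto_log_nhdsGT_zero
        exact tendsto_real_toNNReal_atTop.comp h1
      have h2 := Metric.tendsto_nhds.1 ((tendsto_atTop_zero_nnreal f).comp hlog) δ hδ
      rw [eventually_nhdsWithin_iff] at h2
      filter_upwards [h2] with v hv
      by_cases hv0 : 0 < v
      · simpa [hψ, hv0] using hv hv0
      · simpa [hψ, hv0] using hδ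
    · have h1 : ψ =ᶠ[𝓝 u] fun u => f (-Real.log u).toNNReal := by
        filter_upwards [lt_mem_nhds hu0] with v hv
        simp [hψ, hv]
      refine ContinuousAt.congr ?_ h1.symm
      exact f.continuous.continuousAt.comp (continuous_real_toNNReal.continuousAt.comp
        (Real.continuousAt_log hu0.ne').neg)
  -- The constant term is removed afterwards. It is within `ε / 4` of `ψ 0 = 0`, so the total error
  -- is at most `ε / 2`.
  obtain ⟨p, hp⟩ := exists_polynomial_near_of_continuousOn 0 1 ψ hψc (ε / 4) (by positivity)
  set q := p - Polynomial.C (p.eval 0) with hq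
  have hq0 : q.eval 0 = 0 := by simp [hq]
  refine ⟨polyExp q, polyExp_mem_span hq0, ?_⟩
  rw [dist_eq_norm]
  refine lt_of_le_of_lt (norm_le_of_abs_le (C := ε / 2) (by positivity) fun x => ?_) (by linarith)
  change |f x - polyExp q x| ≤ _
  rw [polyExp_apply hq0]
  have h1 := hp (Real.exp (-x)) ⟨(Real.exp_pos _).le, Real.exp_le_one_iff.2 (by simp)⟩
  have h2 := hp 0 ⟨le_rfl, zero_le_one⟩
  have h3 : ψ (Real.exp (-x)) = f x := by simp [hψ, Real.exp_pos]
  have h4 : ψ 0 = 0 := by simp [hψ]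
  rw [h3] at h1
  rw [h4] at h2
  rw [abs_lt] at h1 h2
  rw [abs_le, hq, Polynomial.eval_sub, Polynomial.eval_C]
  constructor <;> linarith

/-! ### Gamma distributions -/

open MeasureTheory ProbabilityTheory

open Classical in
/-- The gamma distribution with shape `a` and rate `1`, degenerate for `a = 0`. -/
def gammaLaw (a : ℝ) : Measure ℝ≥0 :=
  if 0 < a then (gammaMeasure a 1).map Real.toNNReal else Measure.dirac 0

instance isProbabilityMeasure_gammaLaw (a : ℝ) : IsProbabilityMeasure (gammaLaw a) := by
  unfold gammaLaw
  split_ifs with h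
  · have := isProbabilityMeasure_gammaMeasure h one_pos
    exact Measure.isProbabilityMeasure_map measurable_real_toNNReal.aemeasurable
  · infer_instance

theorem integral_exp_gammaLaw {a l : ℝ} (ha : 0 ≤ a) (hl : 0 < l) :
    ∫ y, Real.exp (-(l * y)) ∂gammaLaw a = (1 + l) ^ (-a) := by
  unfold gammaLaw
  split_ifs with h
  · have hm : Measurable (gammaPDF a 1) := (measurable_gammaPDFReal a 1).ennreal_ofReal
    rw [integral_map measurable_real_toNNReal.aemeasurable
      (by fun_prop : Continuous fun y : ℝ≥0 => Real.exp (-(l * y))).aestronglyMeasurable,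
      gammaMeasure, integral_withDensity_eq_integral_toReal_smul hm
        (Eventually.of_forall fun _ => ENNReal.ofReal_lt_top)]
    have e : ∀ y : ℝ, (gammaPDF a 1 y).toReal • Real.exp (-(l * (y.toNNReal : ℝ)))
        = (Set.Ici 0).indicator
          (fun y : ℝ => (Real.Gamma a)⁻¹ * (y ^ (a - 1) * Real.exp (-((1 + l) * y)))) y := by
      intro y
      rw [gammaPDF, ENNReal.toReal_ofReal (gammaPDFReal_nonneg h one_pos y), gammaPDFReal,
        Set.indicator_apply]
      simp only [Set.mem_Ici, Real.one_rpow]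
      split_ifs with hy
      · rw [Real.coe_toNNReal y hy, smul_eq_mul, add_mul, neg_add, Real.exp_add]
        ring
      · simp
    simp only [e]
    rw [integral_indicator measurableSet_Ici, integral_Ici_eq_integral_Ioi,
      integral_const_mul, Real.integral_rpow_mul_exp_neg_mul_Ioi h (by positivity), one_div,
      Real.inv_rpow (by positivity), ← Real.rpow_neg (by positivity)]
    have := (Real.Gamma_pos_of_pos h).ne'
    field_simp
  · have : a = 0 := le_antisymm (not_lt.1 h) ha
    simp [this]

/-- The expectation with respect to a probability measure on `[0, ∞)`. -/
def expectation (μ : Measure ℝ≥0) [IsProbabilityMeasure μ] : C₀(ℝ≥0, ℝ) →L[ℝ] ℝ :=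
  LinearMap.mkContinuous
    { toFun := fun f => ∫ y, f y ∂μ
      map_add' := fun f g => integral_add (f.toBCF.integrable μ) (g.toBCF.integrable μ)
      map_smul' := fun c f => integral_const_mul c _ } 1
    (fun f => by
      rw [one_mul]
      have := norm_integral_le_of_norm_le_const (μ := μ) (f := f) (C := ‖f‖)
        (Eventually.of_forall fun y => abs_apply_le_norm f y)
      simpa using this)

theorem expectation_apply (μ : Measure ℝ≥0) [IsProbabilityMeasure μ] (f : C₀(ℝ≥0, ℝ)) :
    expectation μ f = ∫ y, f y ∂μ := rfl

theorem norm_expectation_le (μ : Measure ℝ≥0) [IsProbabilityMeasure μ] : ‖expectation μ‖ ≤ 1 :=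
  LinearMap.mkContinuous_norm_le _ zero_le_one _

theorem expectation_gammaLaw_expDecay {a l : ℝ} (ha : 0 ≤ a) (hl : 0 < l) :
    expectation (gammaLaw a) (expDecay l) = (1 + l) ^ (-a) := by
  rw [expectation_apply, ← integral_exp_gammaLaw ha hl]
  simp only [expDecay_apply hl]

/-- The gamma laws escape to infinity as the shape grows: their Laplace transforms `(1 + l) ^ (-(n +
β))` tend to zero. This is why `gammaOperator` takes values in `c₀(ℤ₊)`. -/
theorem tendsto_expectation_gammaLaw {β : ℝ} (hβ : 0 ≤ β) (f : C₀(ℝ≥0, ℝ)) :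
    Tendsto (fun n : ℕ => expectation (gammaLaw (n + β)) f) atTop (𝓝 0) := by
  refine tendsto_apply_of_dense_span (B := 0) (fun n => norm_expectation_le _) (by simp)
    dense_span_expDecay ?_ f
  rintro _ ⟨l, hl, rfl⟩
  have hl' : 0 < l := hl
  have hlim := (tendsto_pow_atTop_nhds_zero_of_lt_one (inv_nonneg.2 (by positivity : 0 ≤ 1 + l))
    (inv_lt_one_of_one_lt₀ (by linarith))).mul_const ((1 + l) ^ (-β))
  rw [zero_mul] at hlim
  refine hlim.congr fun n => ?_
  rw [expectation_gammaLaw_expDecay (by positivity) hl', neg_add, Real.rpow_add (by positivity),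
    Real.rpow_neg (by positivity) (n : ℝ), Real.rpow_natCast, inv_pow]

/-- The operator `f ↦ (n ↦ 𝔼[f(Γ_{n + β})])` from `C₀([0, ∞))` to `c₀(ℤ₊)`. -/
def gammaOperator {β : ℝ} (hβ : 0 ≤ β) : C₀(ℝ≥0, ℝ) →L[ℝ] C₀(ℕ, ℝ) :=
  LinearMap.mkContinuous
    { toFun := fun f => ofNullSequence _ (tendsto_expectation_gammaLaw hβ f)
      map_add' := fun f g => by
        ext n
        exact map_add (expectation (gammaLaw (n + β))) f g
      map_smul' := fun c f => by
        ext n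
        exact map_smul (expectation (gammaLaw (n + β))) c f } 1
    (fun f => by
      rw [one_mul]
      exact norm_le_of_abs_le (norm_nonneg f) fun n =>
        norm_apply_le_of_norm_le_one (norm_expectation_le (gammaLaw (n + β))) f)

theorem gammaOperator_apply {β : ℝ} (hβ : 0 ≤ β) (f : C₀(ℝ≥0, ℝ)) (n : ℕ) :
    gammaOperator hβ f n = expectation (gammaLaw (n + β)) f := rfl

theorem norm_gammaOperator_le {β : ℝ} (hβ : 0 ≤ β) : ‖gammaOperator hβ‖ ≤ 1 :=
  LinearMap.mkContinuous_norm_le _ zero_le_one _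

theorem gammaOperator_expDecay {β : ℝ} (hβ : 0 ≤ β) {l : ℝ} (hl : 0 < l) :
    gammaOperator hβ (expDecay l) = (1 + l) ^ (-β) • geom (l / (1 + l)) := by
  have hp : 0 < 1 + l := by positivity
  ext n
  change _ = (1 + l) ^ (-β) * geom (l / (1 + l)) n
  rw [gammaOperator_apply, expectation_gammaLaw_expDecay (by positivity) hl,
    geom_apply (by positivity) (by rw [div_le_one hp]; linarith), neg_add,
    Real.rpow_add hp, Real.rpow_neg hp.le, Real.rpow_natCast]
  have e : 1 - l / (1 + l) = (1 + l)⁻¹ := by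
    field_simp
    ring
  rw [e, inv_pow, mul_comm]

/-! ### The squared Bessel semigroup in closed form -/

theorem dilation_expDecay (σ : ℝ≥0) (h0 : 0 < σ) {l : ℝ} (hl : 0 < l) :
    dilation σ h0 (expDecay l) = expDecay (σ * l) := by
  have hσ : (0 : ℝ) < σ := h0
  ext x
  rw [dilation_apply, expDecay_apply hl, expDecay_apply (by positivity), NNReal.coe_mul]
  congr 2
  ring

theorem norm_dilation_le (σ : ℝ≥0) (h0 : 0 < σ) : ‖dilation σ h0‖ ≤ 1 :=
  LinearMap.mkContinuous_norm_le _ zero_le_one _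

theorem norm_poissonOperator_le : ‖poissonOperator‖ ≤ 1 :=
  norm_kernelOperator_le isC0MarkovKernel_poissonKernel

theorem poissonOperator_geom_eq {w : ℝ} (h0 : 0 < w) (h1 : w ≤ 1) :
    poissonOperator (geom w) = expDecay w := by
  ext x
  rw [poissonOperator_geom h0 h1, expDecay_apply h0]

open Classical in
/-- The squared Bessel semigroup: at time `t > 0` and started at `x`, the process has the law of
`t Γ_{N + β}`, where `N` is Poisson of parameter `x / t`. -/
def besselFlow {β : ℝ} (hβ : 0 ≤ β) (t : ℝ≥0) : C₀(ℝ≥0, ℝ) →L[ℝ] C₀(ℝ≥0, ℝ) :=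
  if ht : 0 < t then
    (dilation t⁻¹ (inv_pos.2 ht)).comp
      (poissonOperator.comp ((gammaOperator hβ).comp (dilation t ht)))
  else ContinuousLinearMap.id ℝ _

theorem besselFlow_zero {β : ℝ} (hβ : 0 ≤ β) :
    besselFlow hβ 0 = ContinuousLinearMap.id ℝ _ := dif_neg (lt_irrefl 0)

theorem norm_besselFlow_le {β : ℝ} (hβ : 0 ≤ β) (t : ℝ≥0) : ‖besselFlow hβ t‖ ≤ 1 := by
  unfold besselFlow
  split_ifs with ht
  · exact norm_comp_le_one (norm_dilation_le _ _) (norm_comp_le_one norm_poissonOperator_le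
      (norm_comp_le_one (norm_gammaOperator_le hβ) (norm_dilation_le _ _)))
  · exact ContinuousLinearMap.norm_id_le

theorem besselFlow_nonneg {β : ℝ} (hβ : 0 ≤ β) (t : ℝ≥0) {f : C₀(ℝ≥0, ℝ)} (hf : ∀ x, 0 ≤ f x)
    (x : ℝ≥0) : 0 ≤ besselFlow hβ t f x := by
  unfold besselFlow
  split_ifs with ht
  · exact kernelOperator_nonneg isC0MarkovKernel_poissonKernel
      (fun n => integral_nonneg fun y => hf _) _
  · exact hf x

/-- The parameter travels from `l` to `t l` by dilation, to `t l / (1 + t l)` by the gamma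
transform, through `Λ` unchanged, and back by the dilation `1 / t`. -/
theorem besselFlow_expDecay {β : ℝ} (hβ : 0 ≤ β) (t : ℝ≥0) {l : ℝ} (hl : 0 < l) :
    besselFlow hβ t (expDecay l) = (1 + t * l) ^ (-β) • expDecay (l / (1 + t * l)) := by
  rcases eq_zero_or_pos t with rfl | ht
  · simp [besselFlow_zero]
  · have ht' : (0 : ℝ) < t := ht
    have hp : 0 < 1 + t * l := by positivity
    rw [besselFlow, dif_pos ht]
    simp only [ContinuousLinearMap.comp_apply]
    rw [dilation_expDecay t ht hl, gammaOperator_expDecay hβ (by positivity), map_smul, map_smul,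
      poissonOperator_geom_eq (by positivity) (by rw [div_le_one hp]; linarith),
      dilation_expDecay _ _ (by positivity)]
    congr 2
    push_cast
    field_simp

/-- The squared Bessel and the linear birth–death semigroups are intertwined by `Λ`. -/
theorem besselFlow_comp_poissonOperator {β : ℝ} (hβ : 0 ≤ β) (t : ℝ≥0) :
    (besselFlow hβ t).comp poissonOperator = poissonOperator.comp (linearBirthDeath hβ t) := by
  refine ContinuousLinearMap.ext_on dense_span_geom ?_
  rintro _ ⟨w, ⟨h0, h1⟩, rfl⟩
  have hp : 0 < 1 + t * w := by positivity
  rw [ContinuousLinearMap.comp_apply, ContinuousLinearMap.comp_apply,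
    poissonOperator_geom_eq h0 h1.le, besselFlow_expDecay hβ t h0,
    linearBirthDeath_geom hβ t h0 h1.le, map_smul,
    poissonOperator_geom_eq (by positivity)
      (by rw [div_le_one hp]; nlinarith [mul_nonneg t.coe_nonneg h0.le])]

/-- Self-similarity is needed because `Λ` produces from geometric sequences only exponentials of
rate at most `1`; scaling reaches all rates. -/
theorem besselFlow_comp_dilation {β : ℝ} (hβ : 0 ≤ β) (t σ : ℝ≥0) (h0 : 0 < σ) :
    (besselFlow hβ t).comp (dilation σ h0) = (dilation σ h0).comp (besselFlow hβ (σ * t)) := by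
  have hσ : (0 : ℝ) < σ := h0
  refine ContinuousLinearMap.ext_on dense_span_expDecay ?_
  rintro _ ⟨l, hl, rfl⟩
  have hl' : 0 < l := hl
  rw [ContinuousLinearMap.comp_apply, ContinuousLinearMap.comp_apply, dilation_expDecay _ _ hl',
    besselFlow_expDecay hβ _ (by positivity), besselFlow_expDecay hβ _ hl', map_smul,
    dilation_expDecay _ _ (by positivity)]
  congr 2 <;> push_cast
  · ring_nf
  · field_simp

/-! ### The squared Bessel generator on exponentials -/

theorem tendsto_expDecay_generator (β : ℝ) {l : ℝ} (hl : 0 < l) :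
    Tendsto (fun x : ℝ≥0 => (l ^ 2 * x - β * l) * Real.exp (-(l * x))) atTop (𝓝 0) := by
  have h := ((tendsto_one_add_mul_exp_neg hl).const_mul (l ^ 2)).sub
    ((tendsto_exp_neg_mul hl).const_mul (l ^ 2 + β * l))
  simp only [mul_zero, sub_zero] at h
  refine h.congr fun x => ?_
  ring

open Classical in
/-- The function `x ↦ (l² x - β l) e^{-l x}`, the image of `x ↦ e^{-l x}` under `x ∂² + β ∂`. -/
def expDecayGenerator (β l : ℝ) : C₀(ℝ≥0, ℝ) :=
  if hl : 0 < l then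
    ofTendstoAtTop (fun x => (l ^ 2 * x - β * l) * Real.exp (-(l * x))) (by fun_prop)
      (tendsto_expDecay_generator β hl)
  else 0

theorem expDecayGenerator_apply (β : ℝ) {l : ℝ} (hl : 0 < l) (x : ℝ≥0) :
    expDecayGenerator β l x = (l ^ 2 * x - β * l) * Real.exp (-(l * x)) := by
  rw [expDecayGenerator, dif_pos hl, ofTendstoAtTop_apply]

/-- This is the intertwining at the level of generators. The factor `x` in `x ∂²` comes from
shifting the index in the series of `n (1 - w) ^ (n - 1)`. -/
theorem poissonOperator_birthDeathOperator_geom {β w : ℝ} (h0 : 0 < w) (h1 : w ≤ 1)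
    {g : C₀(ℕ, ℝ)}
    (hg : ∀ n, g n = birthDeathOperator (fun n => n + β) (fun n => n) (geom w) n) :
    poissonOperator g = expDecayGenerator β w := by
  ext x
  rw [expDecayGenerator_apply β h0, poissonOperator_apply]
  have hs := (NormedSpace.expSeries_div_hasSum_exp ((1 - w) * x : ℝ)).mul_left (Real.exp (-x))
  rw [← Real.exp_eq_exp_ℝ, ← Real.exp_add,
    (by ring : -(x : ℝ) + (1 - w) * x = -(w * x))] at hs
  have hs1 : HasSum (fun n : ℕ => Real.exp (-x) * (x : ℝ) ^ n / n.factorial *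
      (n * (1 - w) ^ (n - 1))) (x * Real.exp (-(w * x))) := by
    rw [← hasSum_nat_add_iff' 1]
    simp only [Finset.range_one, Finset.sum_singleton, Nat.cast_zero, zero_mul, mul_zero, sub_zero]
    refine (hs.mul_left (x : ℝ)).congr_fun ?_ |> fun h => h
    intro n
    rw [Nat.factorial_succ, Nat.add_sub_cancel, mul_pow]
    push_cast
    field_simp
    ring
  have h := (hs1.mul_left (w * w)).sub (hs.mul_left (w * β))
  rw [(by ring : (w ^ 2 * x - β * w) * Real.exp (-(w * x))
    = w * w * (x * Real.exp (-(w * x))) - w * β * Real.exp (-(w * x))), ← h.tsum_eq]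
  refine tsum_congr fun n => ?_
  rw [hg, birthDeathOperator_geom β h0 h1, mul_pow]
  ring

theorem hasGenerator_besselFlow_expDecay {β : ℝ} (hβ : 0 ≤ β) {l : ℝ} (hl : 0 < l) :
    HasGenerator (besselFlow hβ) (expDecay l) (expDecayGenerator β l) := by
  -- Applying `Λ` to the discrete limit settles the rate `1 / 2`. The dilation by `σ = 2 l` carries
  -- it to the rate `l`, with a factor `σ` from the change of time scale.
  obtain ⟨g, hg, h⟩ := (isBirthDeathSemigroup_linearBirthDeath hβ).generatorMapsTo_geom hβ
    (w := 1 / 2) (by norm_num) (by norm_num)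
  have h1 : HasGenerator (besselFlow hβ) (expDecay (1 / 2)) (expDecayGenerator β (1 / 2)) := by
    rw [← poissonOperator_birthDeathOperator_geom (by norm_num) (by norm_num) hg,
      ← poissonOperator_geom_eq (by norm_num) (by norm_num)]
    refine ((poissonOperator.continuous.tendsto g).comp h).congr fun t => ?_
    rw [Function.comp_apply, map_smul, map_sub, ← ContinuousLinearMap.comp_apply,
      ← besselFlow_comp_poissonOperator]
    rfl
  set σ : ℝ≥0 := (2 * l).toNNReal with hσ
  have hσl : (σ : ℝ) = 2 * l := Real.coe_toNNReal _ (by positivity)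
  have hσ0 : 0 < σ := Real.toNNReal_pos.2 (by positivity)
  have e1 : expDecay l = dilation σ hσ0 (expDecay (1 / 2)) := by
    rw [dilation_expDecay _ _ (by norm_num), hσl]
    congr 1
    ring
  have e2 : expDecayGenerator β l = (σ : ℝ) • dilation σ hσ0 (expDecayGenerator β (1 / 2)) := by
    ext x
    change _ = (σ : ℝ) * expDecayGenerator β (1 / 2) (σ * x)
    rw [expDecayGenerator_apply β hl, expDecayGenerator_apply β (by norm_num), NNReal.coe_mul, hσl,
      (by ring : 1 / 2 * (2 * l * (x : ℝ)) = l * x)]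
    ring
  have hmul : Tendsto (fun t : ℝ≥0 => σ * t) (𝓝[>] 0) (𝓝[>] 0) := by
    refine tendsto_nhdsWithin_iff.2 ⟨?_, ?_⟩
    · have : Continuous fun t : ℝ≥0 => σ * t := by fun_prop
      exact (this.tendsto' 0 0 (by simp)).mono_left nhdsWithin_le_nhds
    · filter_upwards [self_mem_nhdsWithin] with t ht using mul_pos hσ0 ht
  rw [e1, e2]
  refine ((((dilation σ hσ0).continuous.tendsto _).comp
    (Tendsto.comp h1 hmul)).const_smul (σ : ℝ)).congr fun t => ?_
  simp only [Function.comp_apply]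
  rw [← ContinuousLinearMap.comp_apply (besselFlow hβ t), besselFlow_comp_dilation, map_smul,
    map_sub, smul_smul, ContinuousLinearMap.comp_apply]
  congr 1
  have : (σ : ℝ) ≠ 0 := NNReal.coe_ne_zero.2 hσ0.ne'
  push_cast
  rw [mul_inv, mul_inv_cancel_left₀ this]

theorem isFellerSemigroup_besselFlow {β : ℝ} (hβ : 0 ≤ β) :
    IsFellerSemigroup (besselFlow hβ) := by
  refine IsFellerSemigroup.of_dense_span dense_span_expDecay ?_ ?_
    (fun t f hf => besselFlow_nonneg hβ t hf) (norm_besselFlow_le hβ) ?_ dense_span_expDecay ?_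
  · intro f _
    rw [besselFlow_zero]
    rfl
  · rintro s t _ ⟨l, hl, rfl⟩
    have hl' : 0 < l := hl
    rw [besselFlow_expDecay hβ _ hl', besselFlow_expDecay hβ _ hl', map_smul,
      besselFlow_expDecay hβ _ (by positivity), smul_smul,
      ← Real.mul_rpow (by positivity) (by positivity)]
    congr 2 <;> push_cast
    · field_simp
      ring
    · field_simp
      ring
  · intro t x c hc
    have hlim : Tendsto (fun l : ℝ => (1 + t * l) ^ (-β) * Real.exp (-(l / (1 + t * l) * x)))
        (𝓝[>] 0) (𝓝 1) := by
      have h1 := ((tendsto_div_one_add_mul t).mul_const (x : ℝ)).neg.rexp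
      simpa using (tendsto_one_add_mul_rpow t (-β)).mul h1
    obtain ⟨l, hl, hl0⟩ := ((hlim.eventually (lt_mem_nhds hc)).and self_mem_nhdsWithin).exists
    have hl' : 0 < l := hl0
    refine ⟨expDecay l, fun y => ?_, fun y => ?_, ?_⟩
    · rw [expDecay_apply hl']
      positivity
    · rw [expDecay_apply hl', Real.exp_le_one_iff, neg_nonpos]
      positivity
    · rw [besselFlow_expDecay hβ t hl']
      change c < (1 + t * l) ^ (-β) * expDecay (l / (1 + t * l)) x
      rwa [expDecay_apply (by positivity)]
  · rintro _ ⟨l, hl, rfl⟩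
    exact HasGenerator.tendsto (hasGenerator_besselFlow_expDecay hβ hl)

/-! ### The generator of the squared Bessel semigroup on test functions -/

/-- With `u = e^{-x}` the derivative `∂` becomes `-u ∂_u`, so `x ∂² + β ∂` becomes `x (u ∂_u + u²
∂_u²) - β u ∂_u`. The factor `X` removes constants, which are not in `C₀([0, ∞))`. -/
theorem exists_hasGenerator_besselFlow_polynomial {β : ℝ} (hβ : 0 ≤ β) (p : Polynomial ℝ) :
    ∃ f g : C₀(ℝ≥0, ℝ), HasGenerator (besselFlow hβ) f g ∧
      (∀ x, f x = (Polynomial.X * p).eval (Real.exp (-x))) ∧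
      ∀ x, g x = x * (Real.exp (-x) * (Polynomial.X * p).derivative.eval (Real.exp (-x))
          + Real.exp (-x) ^ 2 * (Polynomial.X * p).derivative.derivative.eval (Real.exp (-x)))
        - β * (Real.exp (-x) * (Polynomial.X * p).derivative.eval (Real.exp (-x))) := by
  induction p using Polynomial.induction_on' with
  | add p q hp hq =>
    obtain ⟨f, g, h, hf, hg⟩ := hp
    obtain ⟨f', g', h', hf', hg'⟩ := hq
    refine ⟨f + f', g + g', h.add h', fun x => ?_, fun x => ?_⟩
    · change f x + f' x = _
      rw [hf, hf', mul_add, Polynomial.eval_add]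
    · change g x + g' x = _
      rw [hg, hg', mul_add Polynomial.X, Polynomial.derivative_add, Polynomial.derivative_add,
        Polynomial.eval_add, Polynomial.eval_add]
      ring
  | monomial n a =>
    have hn : (0 : ℝ) < n + 1 := by positivity
    have he : ∀ x : ℝ≥0, Real.exp (-((n + 1 : ℝ) * x)) = Real.exp (-x) ^ (n + 1) := fun x => by
      rw [← Real.exp_nat_mul]
      push_cast
      ring_nf
    refine ⟨a • expDecay (n + 1), a • expDecayGenerator β (n + 1),
      (hasGenerator_besselFlow_expDecay hβ hn).smul a, fun x => ?_, fun x => ?_⟩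
    · change a * expDecay (n + 1) x = _
      rw [expDecay_apply hn, he, Polynomial.X_mul_monomial, Polynomial.eval_monomial]
    · change a * expDecayGenerator β (n + 1) x = _
      rw [expDecayGenerator_apply β hn, he, Polynomial.X_mul_monomial,
        Polynomial.derivative_monomial, Polynomial.derivative_monomial, Polynomial.eval_monomial,
        Polynomial.eval_monomial]
      rcases n with _ | n
      · simp
        ring
      · simp only [Nat.add_sub_cancel]
        push_cast
        ring

/-! ### Approximation in `C²` and the substitution `u = e^{-x}` -/

theorem exists_polynomial_antiderivative (q : Polynomial ℝ) :
    ∃ r : Polynomial ℝ, r.derivative = q ∧ r.eval 0 = 0 := by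
  induction q using Polynomial.induction_on' with
  | add p q hp hq =>
    obtain ⟨r, hr, hr0⟩ := hp
    obtain ⟨r', hr', hr0'⟩ := hq
    exact ⟨r + r', by rw [Polynomial.derivative_add, hr, hr'], by simp [hr0, hr0']⟩
  | monomial n a =>
    refine ⟨Polynomial.monomial (n + 1) (a / (n + 1)), ?_, by simp⟩
    have : (n : ℝ) + 1 ≠ 0 := by positivity
    rw [Polynomial.derivative_monomial, Nat.add_sub_cancel]
    congr 1
    push_cast
    field_simp

/-- On `[0, 1]`, functions vanishing at `0` with `ε`-close derivatives are `ε`-close. -/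
theorem abs_sub_le_of_hasDerivAt {f g f' g' : ℝ → ℝ} {ε : ℝ} (hε : 0 ≤ ε)
    (hf : ∀ u, HasDerivAt f (f' u) u) (hg : ∀ u, HasDerivAt g (g' u) u) (hf0 : f 0 = 0)
    (hg0 : g 0 = 0) (h : ∀ u ∈ Set.Icc (0 : ℝ) 1, |f' u - g' u| ≤ ε) :
    ∀ u ∈ Set.Icc (0 : ℝ) 1, |f u - g u| ≤ ε := by
  intro u hu
  have h1 := Convex.norm_image_sub_le_of_norm_hasDerivWithin_le (f := fun u => f u - g u)
    (fun v _ => ((hf v).sub (hg v)).hasDerivWithinAt) h (convex_Icc (0 : ℝ) 1)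
    (Set.left_mem_Icc.2 zero_le_one) hu
  rw [hf0, hg0, sub_zero, sub_zero, sub_zero, Real.norm_eq_abs, Real.norm_of_nonneg hu.1] at h1
  exact h1.trans (mul_le_of_le_one_right hε hu.2)

/-- Weierstrass approximation in `C²([0, 1])`. -/
theorem exists_polynomial_near_of_hasDerivAt {φ φ' φ'' : ℝ → ℝ} (h : ∀ u, HasDerivAt φ (φ' u) u)
    (h' : ∀ u, HasDerivAt φ' (φ'' u) u) (hc : Continuous φ'') (h0 : φ 0 = 0) (h0' : φ' 0 = 0)
    {ε : ℝ} (hε : 0 < ε) :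
    ∃ p : Polynomial ℝ, ∀ u ∈ Set.Icc (0 : ℝ) 1,
      |(Polynomial.X * p).eval u - φ u| ≤ ε ∧
      |(Polynomial.X * p).derivative.eval u - φ' u| ≤ ε ∧
      |(Polynomial.X * p).derivative.derivative.eval u - φ'' u| ≤ ε := by
  -- The second derivative is approximated and then integrated twice from `0`. The interval has
  -- length one, so the error stays at most `ε`.
  obtain ⟨q, hq⟩ := exists_polynomial_near_of_continuousOn 0 1 φ'' hc.continuousOn ε hε
  obtain ⟨r', hr', hr0'⟩ := exists_polynomial_antiderivative q
  obtain ⟨r, hr, hr0⟩ := exists_polynomial_antiderivative r'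
  have hX : Polynomial.X * r.divX = r := by
    have := r.X_mul_divX_add
    rwa [Polynomial.coeff_zero_eq_eval_zero, hr0, Polynomial.C_0, add_zero] at this
  have h1 := abs_sub_le_of_hasDerivAt hε.le (fun u => hr' ▸ r'.hasDerivAt u) h' hr0' h0'
    fun u hu => (hq u hu).le
  have h2 := abs_sub_le_of_hasDerivAt hε.le (fun u => hr ▸ r.hasDerivAt u) h hr0 h0 h1
  refine ⟨r.divX, fun u hu => ?_⟩
  rw [hX, hr, hr']
  exact ⟨h2 u hu, h1 u hu, (hq u hu).le⟩

/-- The function `G(-log u) / u ^ k` on `(0, ∞)`, extended by zero. -/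
def logPull (G : ℝ → ℝ) (k : ℕ) (u : ℝ) : ℝ :=
  if 0 < u then G (-Real.log u) / u ^ k else 0

theorem logPull_exp_neg (G : ℝ → ℝ) (k : ℕ) (x : ℝ) :
    logPull G k (Real.exp (-x)) = G x / Real.exp (-x) ^ k := by
  simp [logPull, Real.exp_pos]

theorem exists_forall_ge_eq_zero {G : ℝ → ℝ} (hG : HasCompactSupport G) :
    ∃ M, ∀ x ≥ M, G x = 0 := by
  obtain ⟨M, hM⟩ := hG.isCompact.bddAbove
  refine ⟨M + 1, fun x hx => ?_⟩
  by_contra h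
  have := hM (subset_tsupport G h)
  linarith

/-- The family `logPull` is stable under differentiation, which makes pulled-back test functions as
smooth as needed. Near `u = 0` there is nothing to check beyond vanishing: `-log u` leaves the
support of `G`. -/
theorem hasDerivAt_logPull {G G' H : ℝ → ℝ} (hG : ∀ x, HasDerivAt G (G' x) x)
    (hs : HasCompactSupport G) (k : ℕ) (hH : ∀ x, H x = -(G' x + k * G x)) (u : ℝ) :
    HasDerivAt (logPull G k) (logPull H (k + 1) u) u := by
  by_cases hu : 0 < u
  · have e : logPull G k =ᶠ[𝓝 u] fun v => G (-Real.log v) / v ^ k := by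
      filter_upwards [lt_mem_nhds hu] with v hv
      rw [logPull, if_pos hv]
    refine HasDerivAt.congr_of_eventuallyEq ?_ e
    have h1 : HasDerivAt (fun v => G (-Real.log v)) (G' (-Real.log u) * -u⁻¹) u :=
      (hG (-Real.log u)).comp u (Real.hasDerivAt_log hu.ne').neg
    refine (h1.div (hasDerivAt_pow k u) (by positivity)).congr_deriv ?_
    rw [logPull, if_pos hu, hH]
    rcases k with _ | k
    · simp
      field_simp
    · simp only [Nat.add_sub_cancel]
      field_simp
      ring
  · obtain ⟨M, hM⟩ := exists_forall_ge_eq_zero hs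
    have e : logPull G k =ᶠ[𝓝 u] fun _ => 0 := by
      filter_upwards [gt_mem_nhds (lt_of_le_of_lt (not_lt.1 hu) (Real.exp_pos (-M)))] with v hv
      rw [logPull]
      split_ifs with hv0
      · have := (Real.log_lt_iff_lt_exp hv0).2 hv
        rw [hM _ (by linarith), zero_div]
      · rfl
    rw [logPull, if_neg hu]
    exact (hasDerivAt_const u (0 : ℝ)).congr_of_eventuallyEq e

/-- This tames the unbounded coefficient `x` of the generator: in the variable `u` it always occurs
multiplied by `u = e^{-x}`. -/
theorem mul_exp_neg_le_one (x : ℝ) : x * Real.exp (-x) ≤ 1 := by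
  rw [Real.exp_neg, ← div_eq_mul_inv, div_le_one (Real.exp_pos x)]
  linarith [Real.add_one_le_exp x]

theorem generatorMapsTo_besselFlow {β : ℝ} (hβ : 0 ≤ β) {F : ℝ → ℝ} {f : C₀(ℝ≥0, ℝ)}
    (hF : ContDiff ℝ ∞ F) (hs : HasCompactSupport F) (hf : ∀ x : ℝ≥0, f x = F x) :
    GeneratorMapsTo (besselFlow hβ) f (fun x => x * deriv (deriv F) x + β * deriv F x) := by
  have hF1 : ContDiff ℝ ∞ (deriv F) := (contDiff_infty_iff_deriv.1 hF).2
  have hF2 : ContDiff ℝ ∞ (deriv (deriv F)) := (contDiff_infty_iff_deriv.1 hF1).2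
  have hd : ∀ x, HasDerivAt F (deriv F x) x :=
    fun x => (hF.differentiable (by simp) x).hasDerivAt
  have hd1 : ∀ x, HasDerivAt (deriv F) (deriv (deriv F) x) x :=
    fun x => (hF1.differentiable (by simp) x).hasDerivAt
  have hd2 : ∀ x, HasDerivAt (deriv (deriv F)) (deriv (deriv (deriv F)) x) x :=
    fun x => (hF2.differentiable (by simp) x).hasDerivAt
  have hs1 : HasCompactSupport (fun x => -deriv F x) := hs.deriv.neg
  have hs2 : HasCompactSupport (fun x => deriv (deriv F) x + deriv F x) :=
    hs.deriv.deriv.add hs.deriv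
  have hφ := hasDerivAt_logPull (H := fun x => -deriv F x) hd hs 0 (fun x => by simp)
  have hφ1 := hasDerivAt_logPull (H := fun x => deriv (deriv F) x + deriv F x)
    (fun x => (hd1 x).neg) hs1 1 (fun x => by simp only [Pi.neg_apply]; push_cast; ring)
  have hφ2 : Continuous (logPull (fun x => deriv (deriv F) x + deriv F x) 2) :=
    continuous_iff_continuousAt.2 fun u =>
      (hasDerivAt_logPull (fun x => (hd2 x).add (hd1 x)) hs2 2 (fun x => rfl) u).continuousAt
  have hnull : Tendsto (fun x : ℝ≥0 => x * deriv (deriv F) x + β * deriv F x) atTop (𝓝 0) := by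
    obtain ⟨M, hM⟩ := exists_forall_ge_eq_zero hs.deriv
    obtain ⟨M', hM'⟩ := exists_forall_ge_eq_zero hs.deriv.deriv
    refine tendsto_const_nhds.congr' ?_
    have hcoe : Tendsto (fun x : ℝ≥0 => (x : ℝ)) atTop atTop :=
      NNReal.tendsto_coe_atTop.2 tendsto_id
    filter_upwards [hcoe.eventually_ge_atTop M, hcoe.eventually_ge_atTop M'] with x h1 h2
    rw [hM _ h1, hM' _ h2]
    ring
  have hcont : Continuous fun x : ℝ≥0 => x * deriv (deriv F) x + β * deriv F x := by
    have h1 := hF1.continuous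
    have h2 := hF2.continuous
    fun_prop
  refine ⟨ofTendstoAtTop _ hcont hnull, fun x => rfl,
    (isFellerSemigroup_besselFlow hβ).isContractionSemigroup.hasGenerator_of_approx
      fun ε hε => ?_⟩
  -- The error of the generator splits into `x u A`, `x u² B` and `β u A`, where `A` and `B` are the
  -- errors of the first and second derivatives in `u`. Their coefficients are at most `1`, `1` and
  -- `β`, whence the divisor `2 + β`.
  obtain ⟨p, hp⟩ := exists_polynomial_near_of_hasDerivAt hφ hφ1 hφ2 (by simp [logPull])
    (by simp [logPull]) (ε := ε / (2 + β)) (by positivity)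
  obtain ⟨f', g', hfg, hf', hg'⟩ := exists_hasGenerator_besselFlow_polynomial hβ p
  refine ⟨f', g', hfg, norm_le_of_abs_le hε.le fun x => ?_, norm_le_of_abs_le hε.le fun x => ?_⟩
  · obtain ⟨h1, -, -⟩ := hp (Real.exp (-x)) ⟨(Real.exp_pos _).le, Real.exp_le_one_iff.2 (by simp)⟩
    change |f' x - f x| ≤ ε
    rw [logPull_exp_neg, pow_zero, div_one] at h1
    rw [hf', hf]
    exact h1.trans (div_le_self hε.le (by linarith))
  · obtain ⟨-, h1, h2⟩ := hp (Real.exp (-x)) ⟨(Real.exp_pos _).le, Real.exp_le_one_iff.2 (by simp)⟩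
    change |g' x - (x * deriv (deriv F) x + β * deriv F x)| ≤ ε
    rw [logPull_exp_neg] at h1 h2
    rw [hg']
    have hu0 := Real.exp_pos (-(x : ℝ))
    have hu1 : Real.exp (-(x : ℝ)) ≤ 1 := Real.exp_le_one_iff.2 (by simp)
    have hxu := mul_exp_neg_le_one x
    have hx := x.coe_nonneg
    set u := Real.exp (-(x : ℝ))
    set A := (Polynomial.X * p).derivative.eval u - -deriv F x / u ^ (0 + 1) with hA
    set B := (Polynomial.X * p).derivative.derivative.eval u
      - (deriv (deriv F) x + deriv F x) / u ^ (1 + 1) with hB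
    have e : x * (u * (Polynomial.X * p).derivative.eval u
        + u ^ 2 * (Polynomial.X * p).derivative.derivative.eval u)
        - β * (u * (Polynomial.X * p).derivative.eval u)
        - (x * deriv (deriv F) x + β * deriv F x)
        = (x * u) * A + (x * u) * u * B - β * u * A := by
      rw [hA, hB]
      field_simp
      ring
    rw [e]
    have hη : 0 ≤ ε / (2 + β) := by positivity
    have hxu0 : 0 ≤ x * u := by positivity
    have k1 : |x * u * A| ≤ ε / (2 + β) := by
      rw [abs_mul, abs_of_nonneg hxu0]
      exact (mul_le_of_le_one_left (abs_nonneg A) hxu).trans h1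
    have k2 : |x * u * u * B| ≤ ε / (2 + β) := by
      rw [abs_mul, abs_of_nonneg (by positivity)]
      exact (mul_le_of_le_one_left (abs_nonneg B) (mul_le_one₀ hxu hu0.le hu1)).trans h2
    have k3 : |β * u * A| ≤ β * (ε / (2 + β)) := by
      rw [abs_mul, abs_mul, abs_of_nonneg hβ, abs_of_nonneg hu0.le, mul_assoc]
      exact mul_le_mul_of_nonneg_left
        ((mul_le_of_le_one_left (abs_nonneg A) hu1).trans h1) hβ
    calc |x * u * A + x * u * u * B - β * u * A|
        ≤ |x * u * A| + |x * u * u * B| + |β * u * A| :=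
          (abs_sub _ _).trans (add_le_add (abs_add_le _ _) le_rfl)
      _ ≤ ε / (2 + β) + ε / (2 + β) + β * (ε / (2 + β)) := by linarith
      _ = ε := by field_simp; ring

theorem isSquaredBesselSemigroup_besselFlow {β : ℝ} (hβ : 0 ≤ β) :
    IsSquaredBesselSemigroup β (besselFlow hβ) :=
  ⟨isFellerSemigroup_besselFlow hβ, fun _ _ hF hs hf => generatorMapsTo_besselFlow hβ hF hs hf⟩

/-! ### Uniqueness of the squared Bessel semigroup -/

/-- A smooth cutoff function. -/
theorem exists_cutoff : ∃ (χ : ℝ → ℝ) (C : ℝ), ContDiff ℝ ∞ χ ∧ HasCompactSupport χ ∧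
    (∀ y, 0 ≤ χ y ∧ χ y ≤ 1) ∧ (∀ y, |y| < 1 → χ y = 1 ∧ deriv χ y = 0 ∧ deriv (deriv χ) y = 0) ∧
    (∀ y, |deriv χ y| ≤ C) ∧ ∀ y, |deriv (deriv χ) y| ≤ C := by
  let χ : ContDiffBump (0 : ℝ) := ⟨1, 2, one_pos, one_lt_two⟩
  have hχ : ContDiff ℝ ∞ χ := χ.contDiff
  have hχ1 : ContDiff ℝ ∞ (deriv χ) := (contDiff_infty_iff_deriv.1 hχ).2
  have hχ2 : ContDiff ℝ ∞ (deriv (deriv χ)) := (contDiff_infty_iff_deriv.1 hχ1).2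
  have hs : HasCompactSupport χ := χ.hasCompactSupport
  obtain ⟨C, hC⟩ := hs.deriv.exists_bound_of_continuous hχ1.continuous
  obtain ⟨C', hC'⟩ := hs.deriv.deriv.exists_bound_of_continuous hχ2.continuous
  have h1 : ∀ y ∈ Metric.ball (0 : ℝ) 1, χ y = 1 :=
    fun y hy => χ.one_of_mem_closedBall (Metric.ball_subset_closedBall hy)
  have h2 : ∀ y ∈ Metric.ball (0 : ℝ) 1, deriv χ y = 0 := fun y hy => by
    have : χ =ᶠ[𝓝 y] fun _ => (1 : ℝ) := by
      filter_upwards [Metric.isOpen_ball.mem_nhds hy] with z hz using h1 z hz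
    rw [this.deriv_eq, deriv_const]
  have h3 : ∀ y ∈ Metric.ball (0 : ℝ) 1, deriv (deriv χ) y = 0 := fun y hy => by
    have : deriv χ =ᶠ[𝓝 y] fun _ => (0 : ℝ) := by
      filter_upwards [Metric.isOpen_ball.mem_nhds hy] with z hz using h2 z hz
    rw [this.deriv_eq, deriv_const]
  refine ⟨χ, max C C', hχ, hs, fun y => ⟨χ.nonneg, χ.le_one⟩, fun y hy => ?_,
    fun y => (hC y).trans (le_max_left _ _), fun y => (hC' y).trans (le_max_right _ _)⟩
  have hy' : y ∈ Metric.ball (0 : ℝ) 1 := by simpa using hy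
  exact ⟨h1 y hy', h2 y hy', h3 y hy'⟩

theorem hasDerivAt_exp_neg_mul (l x : ℝ) :
    HasDerivAt (fun y => Real.exp (-(l * y))) (-(l * Real.exp (-(l * x)))) x := by
  have h := ((hasDerivAt_id x).const_mul l).neg.exp
  refine h.congr_deriv ?_
  simp only [Pi.neg_apply, id, mul_one]
  ring

/-- Exponential functions are in the domain of the generator of the squared Bessel semigroup. -/
theorem IsSquaredBesselSemigroup.hasGenerator_expDecay {β : ℝ} (hβ : 0 ≤ β)
    {T : ℝ≥0 → C₀(ℝ≥0, ℝ) →L[ℝ] C₀(ℝ≥0, ℝ)} (hT : IsSquaredBesselSemigroup β T) {l : ℝ}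
    (hl : 0 < l) : HasGenerator T (expDecay l) (expDecayGenerator β l) := by
  obtain ⟨χ, C, hχ, hs, hχ01, hχ1, hC, hC'⟩ := exists_cutoff
  have hC0 : 0 ≤ C := (abs_nonneg _).trans (hC 0)
  have hd : ∀ x, HasDerivAt χ (deriv χ x) x :=
    fun x => (hχ.differentiable (by simp) x).hasDerivAt
  have hd1 : ∀ x, HasDerivAt (deriv χ) (deriv (deriv χ) x) x :=
    fun x => ((contDiff_infty_iff_deriv.1 hχ).2.differentiable (by simp) x).hasDerivAt
  refine hT.feller.isContractionSemigroup.hasGenerator_of_approx fun ε hε => ?_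
  -- The three summands bound the error of the function, of the `x ∂²` term and of the `β ∂` term,
  -- after `e^{-l x}` and the growth `1 + x` are factored out.
  set K := 1 + (l ^ 2 + 2 * l * C + C) + β * (l + C) with hK
  have hlim := (tendsto_one_add_mul_exp_neg hl).const_mul K
  rw [mul_zero] at hlim
  obtain ⟨X, hX⟩ := Metric.tendsto_atTop.1 hlim ε hε
  -- At this scale the cutoff is identically `1` below `X`, so all errors sit where the exponential
  -- is small. Since `s ≤ 1`, the bounds on the derivatives of the cutoff do not deteriorate.
  set s : ℝ := 1 / (X + 1) with hs_def
  have hs0 : 0 < s := by positivity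
  have hs1 : s ≤ 1 := by
    rw [hs_def, div_le_one (by positivity)]
    linarith [X.coe_nonneg]
  have hsX : ∀ x : ℝ≥0, x < X → |s * x| < 1 := fun x hx => by
    rw [abs_of_nonneg (by positivity), hs_def, one_div, ← div_eq_inv_mul,
      div_lt_one (by positivity)]
    have : (x : ℝ) < X := hx
    linarith
  have hdχ : ∀ x, HasDerivAt (fun y => χ (s * y)) (s * deriv χ (s * x)) x := fun x => by
    have := (hd (s * x)).comp x ((hasDerivAt_id x).const_mul s)
    refine this.congr_deriv ?_
    ring
  have hdχ1 : ∀ x, HasDerivAt (fun y => deriv χ (s * y)) (s * deriv (deriv χ) (s * x)) x :=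
    fun x => by
      have := (hd1 (s * x)).comp x ((hasDerivAt_id x).const_mul s)
      refine this.congr_deriv ?_
      ring
  set F : ℝ → ℝ := fun x => Real.exp (-(l * x)) * χ (s * x) with hF
  have hF1 : deriv F = fun x => Real.exp (-(l * x)) * (-l * χ (s * x) + s * deriv χ (s * x)) := by
    funext x
    refine ((hasDerivAt_exp_neg_mul l x).mul (hdχ x)).deriv.trans ?_
    ring
  have hF2 : deriv (deriv F) = fun x => Real.exp (-(l * x)) * (l ^ 2 * χ (s * x)
      - 2 * l * s * deriv χ (s * x) + s ^ 2 * deriv (deriv χ) (s * x)) := by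
    rw [hF1]
    funext x
    refine ((hasDerivAt_exp_neg_mul l x).mul
      (((hdχ x).const_mul (-l)).add ((hdχ1 x).const_mul s))).deriv.trans ?_
    simp only [Pi.add_apply]
    ring
  have hFc : ContDiff ℝ ∞ F := by
    have h1 : ContDiff ℝ ∞ fun x : ℝ => χ (s * x) := hχ.comp (contDiff_const.mul contDiff_id)
    have h2 : ContDiff ℝ ∞ fun x : ℝ => Real.exp (-(l * x)) :=
      (contDiff_const.mul contDiff_id).neg.exp
    exact h2.mul h1
  have hFs : HasCompactSupport F := (hs.comp_smul hs0.ne').mul_left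
  have hbound : ∀ x : ℝ≥0, |F x| ≤ Real.exp (-(l * x)) := fun x => by
    rw [hF, abs_mul, abs_of_pos (Real.exp_pos _), abs_of_nonneg (hχ01 _).1]
    exact mul_le_of_le_one_right (Real.exp_pos _).le (hχ01 _).2
  have hnull : Tendsto (fun x : ℝ≥0 => F x) atTop (𝓝 0) :=
    squeeze_zero_norm hbound (tendsto_exp_neg_mul hl)
  obtain ⟨g, hg, hTg⟩ := hT.generator F (ofTendstoAtTop (fun x : ℝ≥0 => F x)
    (hFc.continuous.comp NNReal.continuous_coe) hnull) hFc hFs (fun x => rfl)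
  have htail : ∀ x : ℝ≥0, X ≤ x → K * ((1 + (x : ℝ)) * Real.exp (-(l * x))) ≤ ε := fun x hx => by
    have := hX x hx
    rw [Real.dist_eq, sub_zero] at this
    exact ((le_abs_self _).trans_lt this).le
  refine ⟨_, g, hTg, norm_le_of_abs_le hε.le fun x => ?_, norm_le_of_abs_le hε.le fun x => ?_⟩
  · change |F x - expDecay l x| ≤ ε
    rw [expDecay_apply hl]
    rcases lt_or_ge x X with hx | hx
    · simp only [hF, (hχ1 _ (hsX x hx)).1]
      simpa using hε.le
    · refine le_trans ?_ (htail x hx)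
      have e : F x - Real.exp (-(l * x)) = -(Real.exp (-(l * x)) * (1 - χ (s * x))) := by
        rw [hF]
        ring
      have hE := Real.exp_pos (-(l * (x : ℝ)))
      rw [e, abs_neg, abs_of_nonneg (mul_nonneg hE.le (by linarith [(hχ01 (s * x)).2]))]
      have hK1 : 1 ≤ K := by
        have : 0 ≤ (l ^ 2 + 2 * l * C + C) + β * (l + C) := by positivity
        linarith
      have hx0 := x.coe_nonneg
      have h1 : Real.exp (-(l * x)) * (1 - χ (s * x)) ≤ Real.exp (-(l * x)) :=
        mul_le_of_le_one_right hE.le (by linarith [(hχ01 (s * x)).1])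
      have h2 : Real.exp (-(l * x)) ≤ (1 + (x : ℝ)) * Real.exp (-(l * x)) :=
        le_mul_of_one_le_left hE.le (by linarith)
      have h3 : (1 + (x : ℝ)) * Real.exp (-(l * x)) ≤ K * ((1 + (x : ℝ)) * Real.exp (-(l * x))) :=
        le_mul_of_one_le_left (by positivity) hK1
      linarith
  · change |g x - expDecayGenerator β l x| ≤ ε
    have e : g x - expDecayGenerator β l x = Real.exp (-(l * x)) *
        (x * (l ^ 2 * (χ (s * x) - 1) - 2 * l * s * deriv χ (s * x)
          + s ^ 2 * deriv (deriv χ) (s * x))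
        + β * (-l * (χ (s * x) - 1) + s * deriv χ (s * x))) := by
      rw [hg, expDecayGenerator_apply β hl, hF2, hF1]
      ring
    rw [e]
    rcases lt_or_ge x X with hx | hx
    · obtain ⟨h1, h2, h3⟩ := hχ1 _ (hsX x hx)
      rw [h1, h2, h3]
      simpa using hε.le
    · refine le_trans ?_ (htail x hx)
      have hE := Real.exp_pos (-(l * (x : ℝ)))
      have hx0 := x.coe_nonneg
      rw [abs_mul, abs_of_pos hE]
      have a1 : |χ (s * x) - 1| ≤ 1 := by
        rw [abs_le]
        constructor <;> linarith [(hχ01 (s * x)).1, (hχ01 (s * x)).2]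
      have a2 : |s * deriv χ (s * x)| ≤ C := by
        rw [abs_mul, abs_of_pos hs0]
        exact (mul_le_of_le_one_left (abs_nonneg _) hs1).trans (hC _)
      have a3 : |s ^ 2 * deriv (deriv χ) (s * x)| ≤ C := by
        rw [abs_mul, abs_of_nonneg (by positivity)]
        exact (mul_le_of_le_one_left (abs_nonneg _) (pow_le_one₀ hs0.le hs1)).trans (hC' _)
      rw [abs_le] at a1 a2 a3
      have b1 : |l ^ 2 * (χ (s * x) - 1) - 2 * l * s * deriv χ (s * x)
          + s ^ 2 * deriv (deriv χ) (s * x)| ≤ l ^ 2 + 2 * l * C + C := by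
        have h1 := mul_le_mul_of_nonneg_left a1.1 (sq_nonneg l)
        have h2 := mul_le_mul_of_nonneg_left a1.2 (sq_nonneg l)
        have h3 := mul_le_mul_of_nonneg_left a2.1 (by positivity : 0 ≤ 2 * l)
        have h4 := mul_le_mul_of_nonneg_left a2.2 (by positivity : 0 ≤ 2 * l)
        rw [abs_le]
        constructor <;> linarith
      have b2 : |-l * (χ (s * x) - 1) + s * deriv χ (s * x)| ≤ l + C := by
        have h1 := mul_le_mul_of_nonneg_left a1.1 hl.le
        have h2 := mul_le_mul_of_nonneg_left a1.2 hl.le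
        rw [abs_le]
        constructor <;> linarith
      have b3 := abs_add_le (x * (l ^ 2 * (χ (s * x) - 1) - 2 * l * s * deriv χ (s * x)
          + s ^ 2 * deriv (deriv χ) (s * x))) (β * (-l * (χ (s * x) - 1) + s * deriv χ (s * x)))
      rw [abs_mul (x : ℝ), abs_mul β, abs_of_nonneg hx0, abs_of_nonneg hβ] at b3
      have b4 := mul_le_mul_of_nonneg_left b1 hx0
      have b5 := mul_le_mul_of_nonneg_left b2 hβ
      have b6 : x * (l ^ 2 + 2 * l * C + C) + β * (l + C) ≤ K * (1 + x) := by
        have c1 : 0 ≤ l ^ 2 + 2 * l * C + C := by positivity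
        have c2 : 0 ≤ x * (β * (l + C)) := by positivity
        rw [hK]
        linarith
      calc Real.exp (-(l * x)) * _ ≤ Real.exp (-(l * x)) * (K * (1 + x)) :=
            mul_le_mul_of_nonneg_left (by linarith) hE.le
        _ = K * ((1 + (x : ℝ)) * Real.exp (-(l * x))) := by ring

/-- As in the discrete case, the orbit of an exponential stays among multiples of exponentials,
where both generators are known to agree. -/
theorem IsSquaredBesselSemigroup.eq_besselFlow {β : ℝ} (hβ : 0 ≤ β)
    {T : ℝ≥0 → C₀(ℝ≥0, ℝ) →L[ℝ] C₀(ℝ≥0, ℝ)} (hT : IsSquaredBesselSemigroup β T) :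
    T = besselFlow hβ := by
  funext t
  refine ContinuousLinearMap.ext_on dense_span_expDecay ?_
  rintro _ ⟨l, hl, rfl⟩
  have hl' : 0 < l := hl
  refine hT.feller.isContractionSemigroup.apply_eq_of_hasGenerator
    (isFellerSemigroup_besselFlow hβ).isContractionSemigroup (fun s => ?_) t
  rw [besselFlow_expDecay hβ s hl']
  exact ⟨_, (hT.hasGenerator_expDecay hβ (by positivity)).smul _,
    (hasGenerator_besselFlow_expDecay hβ (by positivity)).smul _⟩

theorem squaredBessel_eq {β : ℝ} (hβ : 0 ≤ β) : squaredBessel β = besselFlow hβ := by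
  have h : ∃! T, IsSquaredBesselSemigroup β T :=
    ⟨besselFlow hβ, isSquaredBesselSemigroup_besselFlow hβ,
      fun T hT => IsSquaredBesselSemigroup.eq_besselFlow hβ hT⟩
  rw [squaredBessel, dif_pos h]
  exact IsSquaredBesselSemigroup.eq_besselFlow hβ h.choose_spec.1

/-! ### Intertwining of the Laguerre semigroups -/

theorem continuousLaguerre_comp_poissonOperator {β : ℝ} (hβ : 0 ≤ β) (t : ℝ≥0) :
    (continuousLaguerre β t).comp poissonOperator
      = poissonOperator.comp (discreteLaguerre β t) := by
  -- A thinned Poisson variable is Poisson with reduced parameter: both sides send `geom w` to the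
  -- exponential of rate `e^{-t} w`.
  have hd : ∀ (h0 : 0 < (Real.exp (-t)).toNNReal) (h0' : 0 < Real.exp (-t))
      (h1 : Real.exp (-t) ≤ 1), (dilation (Real.exp (-t)).toNNReal h0).comp poissonOperator
        = poissonOperator.comp (discreteDilation (Real.exp (-t)) h0' h1) := by
    intro h0 h0' h1
    refine ContinuousLinearMap.ext_on dense_span_geom ?_
    rintro _ ⟨w, ⟨hw0, hw1⟩, rfl⟩
    rw [ContinuousLinearMap.comp_apply, ContinuousLinearMap.comp_apply,
      poissonOperator_geom_eq hw0 hw1.le, dilation_expDecay _ _ hw0,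
      discreteDilation_geom _ _ hw0 hw1.le,
      poissonOperator_geom_eq (by positivity) (mul_le_one₀ h1 hw0.le hw1.le),
      Real.coe_toNNReal _ h0'.le]
  rw [continuousLaguerre, discreteLaguerre, squaredBessel_eq hβ, discreteBessel_eq hβ,
    ContinuousLinearMap.comp_assoc, hd _ (Real.exp_pos _) (Real.exp_le_one_iff.2 (by simp)),
    ← ContinuousLinearMap.comp_assoc, besselFlow_comp_poissonOperator,
    ContinuousLinearMap.comp_assoc]

end Gateway

end

theorem theorem2 (β : ℝ) (hβ : 0 ≤ β) :
    Gateway.IsBirthDeathSemigroup (fun n : ℕ => (n : ℝ) + β) (fun n : ℕ => 2 * (n : ℝ))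
        (Gateway.discreteLaguerre β) ∧
      ∀ t : NNReal,
        (Gateway.continuousLaguerre β t).comp Gateway.poissonOperator
          = Gateway.poissonOperator.comp (Gateway.discreteLaguerre β t) :=
  ⟨Gateway.isBirthDeathSemigroup_discreteLaguerre hβ,
    Gateway.continuousLaguerre_comp_poissonOperator hβ⟩
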